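/- Let $\mathcal X$ and $\widehat{\mathcal X}$ be finite alphabets, $\widehat{\mathcal X}\neq\emptyset$, let $d:\mathcal X\times\widehat{\mathcal X}\to[0,\infty)$ be a distortion measure, and let $m\ge 1$. At each time $k=1,2,\dots$ a memoryless source emits a vector $(x_{1,k},\dots,x_{m,k})\in\mathcal X^m$ (the outputs of $m$ possibly dependent subsources); these vectors are i.i.d. over time with joint law $P$. A switcher with $1$-step lookahead chooses, at each time $k$, a switch position $s_k\in\{1,\dots,m\}$ as a possibly random function of all subsource outputs at times $1,\dots,k$ (the random choices at different times may be dependent), and the letter $x_k=x_{s_k,k}$ is output. For a codebook, i.e. a nonempty set $\mathcal B\subseteq\widehat{\mathcal X}^n$, put $d_n(\mathbf x^n;\mathcal B)=\min_{\widehat{\mathbf x}^n\in\mathcal B}\frac1n\sum_{k=1}^n d(x_k,\widehat x_k)$. The switcher is helpful: a rate $R$ is achievable at distortion $D$ if for each $n\ge1$ there are a codebook $\mathcal B_n\subseteq\widehat{\mathcal X}^n$ and a switcher strategy with $\mathbb E[d_n(\mathbf x^n;\mathcal B_n)]\le D$ such that $\frac1n\ln|\mathcal B_n|\to R$ as $n\to\infty$.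 Let $R(D)\in[0,\infty]$ be the infimum of the rates achievable at distortion $D$ ($\infty$ if there are none); at the single point $D=D_{\min}$ defined below, $R(D)$ is by convention the limit of this infimum from the right. For a probability distribution $p$ on a finite set $\mathcal A$ and a distortion measure $\delta:\mathcal A\times\widehat{\mathcal X}\to[0,\infty)$, the rate-distortion function of the i.i.d. source with distribution $p$ with respect to $\delta$ at distortion $D$ is the minimum of the mutual information $$I(p,W)=\sum_{a,\widehat x}p(a)W(\widehat x|a)\ln\frac{W(\widehat x|a)}{\sum_{a'}p(a')W(\widehat x|a')}$$ over the transition matrices $W$ from $\mathcal A$ to $\widehat{\mathcal X}$ with $\sum_{a,\widehat x}p(a)W(\widehat x|a)\delta(a,\widehat x)\le D$, and it is $\infty$ if there is no such $W$. Let $R(p,D)$ be this function for a distribution $p$ on $\mathcal X$ and $\delta=d$. Let $\mathcal X^*=\{\mathcal V\subseteq\mathcal X:\mathcal V\ne\emptyset,\ |\mathcal V|\le m\}$, $\rho(\mathcal V,\widehat x)=\min_{x\in\mathcal V}d(x,\widehat x)$ and $\beta(\mathcal V)=P(\{x_{1,1},\dots,x_{m,1}\}=\mathcal V)$, and let $R^*(\beta,D)$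 be the rate-distortion function of the i.i.d. source on $\mathcal X^*$ with distribution $\beta$ with respect to $\rho$. Let $D_{\min}=\sum_{\mathcal V\in\mathcal X^*}\beta(\mathcal V)\min_{\widehat x}\rho(\mathcal V,\widehat x)$, and let $\mathcal C$ be the set of probability distributions $p$ on $\mathcal X$ with $$\sum_{i\in\mathcal V}p(i)\ \ge\ P(x_{l,1}\in\mathcal V\text{ for all }1\le l\le m)\qquad\text{for every }\mathcal V\subseteq\mathcal X.$$ Then, for every $D\in\mathbb R$, the minimum $\min_{p\in\mathcal C}R(p,D)\in[0,\infty]$ is attained, and $$R^*(\beta,D)\ \le\ R(D)\ \le\ \min_{p\in\mathcal C}R(p,D).$$ -/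

import Mathlib

namespace HelpfulAVS

open Filter Topology

/-! ## The information rate-distortion function of a memoryless source -/

section Source

variable {α γ : Type*} [Fintype α] [Fintype γ]

/-- Mutual information `I(p, W)` in nats between an input with law `p` and the output of the
transition matrix `W`, where `W x y = W(y | x)`. Terms with `p x * W x y = 0` vanish. -/
noncomputable def mutualInfo (p : α → ℝ) (W : α → γ → ℝ) : ℝ :=
  ∑ x, ∑ y, p x * W x y * Real.log (W x y / ∑ x', p x' * W x' y)

/-- The transition matrices from `α` to `γ` whose average distortion `∑ p(x) W(y|x) δ(x,y)`
is at most `D`. -/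
def feasibleChannels (p : α → ℝ) (δ : α → γ → ℝ) (D : ℝ) : Set (α → γ → ℝ) :=
  {W | (∀ x, W x ∈ stdSimplex ℝ γ) ∧ ∑ x, ∑ y, p x * W x y * δ x y ≤ D}

/-- The rate-distortion function `R(p, D)` of the memoryless source with law `p` for the distortion
measure `δ`: the minimum of `I(p, W)` over the channels meeting the distortion constraint,
and `⊤` if there is none, that is, for `D` below `minDistortion p δ`. -/
noncomputable def rateDist (p : α → ℝ) (δ : α → γ → ℝ) (D : ℝ) : EReal :=
  ⨅ W ∈ feasibleChannels p δ D, (mutualInfo p W : EReal)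

/-- `D_min(p) = ∑ p(x) min_y δ(x,y)`, the minimum average distortion achievable for `p`. -/
noncomputable def minDistortion [Nonempty γ] (p : α → ℝ) (δ : α → γ → ℝ) : ℝ :=
  ∑ x, p x * Finset.univ.inf' Finset.univ_nonempty (δ x)

end Source

/-! ## Block codes and the switcher -/

section Switcher

variable {X Y : Type*} {m n : ℕ}

/-- The per-letter distortion of blocks, `d_n(x, y) = (1/n) ∑ d(x_k, y_k)`. -/
noncomputable def blockDist (d : X → Y → ℝ) (x : Fin n → X) (y : Fin n → Y) : ℝ :=
  (∑ k, d (x k) (y k)) / n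

/-- A codebook of block length `n`: a nonempty finite set of reconstruction blocks. -/
abbrev Codebook (Y : Type*) (n : ℕ) : Type _ := {B : Finset (Fin n → Y) // B.Nonempty}

/-- `d_n(x; B)`, the distortion of the best codeword for the block `x`. -/
noncomputable def codebookDist (d : X → Y → ℝ) (x : Fin n → X) (B : Codebook Y n) : ℝ :=
  B.1.inf' B.2 (fun y => blockDist d x y)

/-- A randomized switcher strategy with 1-step lookahead for blocks of length `n`. At time `k` the
switch position is drawn from a law on `Fin m` that may depend on the outputs of all `m` subsources
at the times up to and including `k`, and on the switch positions chosen before. -/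
structure OneStepStrategy (X : Type*) (m n : ℕ) where
  /-- The law of the switch position at time `k`. -/
  law : (k : Fin n) → (Set.Iic k → Fin m → X) → (Set.Iio k → Fin m) → Fin m → ℝ
  law_mem : ∀ k x s, law k x s ∈ stdSimplex ℝ (Fin m)

/-- The conditional probability of the switch positions `s` given the subsource outputs `x`, where
`x k l` is the output of subsource `l` at time `k`. -/
noncomputable def OneStepStrategy.prob (σ : OneStepStrategy X m n) (x : Fin n → Fin m → X)
    (s : Fin n → Fin m) : ℝ :=
  ∏ k, σ.law k (fun j => x j) (fun j => s j) (s k)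

/-- The expected distortion `E[d_n(x; B)]` when the subsource outputs are iid over time with joint
law `P` on `Fin m → X` and the switcher, using `σ`, outputs the letters `x k (s k)`. -/
noncomputable def expectedDist [Fintype X] (P : (Fin m → X) → ℝ) (d : X → Y → ℝ)
    (B : Codebook Y n) (σ : OneStepStrategy X m n) : ℝ :=
  ∑ x : Fin n → Fin m → X, (∏ k, P (x k)) *
    ∑ s : Fin n → Fin m, σ.prob x s * codebookDist d (fun k => x k (s k)) B

/-- A rate `R` is achievable at distortion `D` for the helpful switcher with 1-step lookahead if
for each block length there are a codebook and a strategy (which may be adapted to the codebook)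
with expected distortion at most `D`, such that the rates of the codebooks tend to `R`. -/
def Achievable [Fintype X] (P : (Fin m → X) → ℝ) (d : X → Y → ℝ) (D R : ℝ) : Prop :=
  ∃ (B : (n : ℕ) → Codebook Y n) (σ : (n : ℕ) → OneStepStrategy X m n),
    (∀ n, 1 ≤ n → expectedDist P d (B n) (σ n) ≤ D) ∧
    Tendsto (fun n : ℕ => Real.log ((B n).1.card) / n) atTop (𝓝 R)

/-- The infimum of the achievable rates at distortion `D`, `⊤` if there is none. -/
noncomputable def infAchievable [Fintype X] (P : (Fin m → X) → ℝ) (d : X → Y → ℝ) (D : ℝ) :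
    EReal :=
  ⨅ R ∈ {R : ℝ | Achievable P d D R}, (R : EReal)

/-! ## Candidate sets -/

/-- The nonempty subsets of `X` with at most `m` elements. -/
abbrev CandidateSet (X : Type*) (m : ℕ) : Type _ := {V : Finset X // V.Nonempty ∧ V.card ≤ m}

/-- `β(V) = P({x_1, …, x_m} = V)`, the law of the set of letters offered to the switcher. -/
noncomputable def candidateLaw [Fintype X] [DecidableEq X] (P : (Fin m → X) → ℝ)
    (V : CandidateSet X m) : ℝ :=
  ∑ x : Fin m → X with Finset.univ.image x = V.1, P x

/-- `ρ(V, y) = min_{x ∈ V} d(x, y)`. -/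
noncomputable def candidateDist (d : X → Y → ℝ) (V : CandidateSet X m) (y : Y) : ℝ :=
  V.1.inf' V.2.1 (fun x => d x y)

/-- The set `C` of the laws `p` on `X` with `∑_{i ∈ V} p(i) ≥ P(x_l ∈ V for all l)` for every
`V ⊆ X`. -/
def simulableLaws [Fintype X] [DecidableEq X] (P : (Fin m → X) → ℝ) : Set (X → ℝ) :=
  {p | p ∈ stdSimplex ℝ X ∧
    ∀ V : Finset X, ∑ x : Fin m → X with ∀ l, x l ∈ V, P x ≤ ∑ i ∈ V, p i}

/-- The rate-distortion function `R(D)` of the arbitrarily varying source with a helpful switcher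
with 1-step lookahead. At the smallest distortion any code and strategy can reach, it is by
convention the limit from the right; `infAchievable P d` is antitone, so that this
limit is the supremum over all larger distortions. -/
noncomputable def helpfulRate [Fintype X] [DecidableEq X] [Fintype Y] [Nonempty Y]
    (P : (Fin m → X) → ℝ) (d : X → Y → ℝ) (D : ℝ) : EReal :=
  open scoped Classical in
  if D = minDistortion (candidateLaw P) (candidateDist (m := m) d) then
    ⨆ D' > D, infAchievable P d D'
  else infAchievable P d D

end Switcher

end HelpfulAVS

namespace HelpfulAVS

open Filter Topology

/-! Lower bound. Whatever the switcher does, the letter output at time `k` belongs to the set of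
letters offered at time `k`, so its distortion to any codeword letter is at least `ρ` of that set. A
code with any strategy is therefore at least as distorted as the same code used on the i.i.d. source
of offered sets, and the converse for memoryless sources applies to each block length
(`rateDist_le_log_card`).

Upper bound. Every law in `C` is the output law of a memoryless randomized switching rule
(`exists_switchLaw_eq`). The laws of such rules form a compact convex set, so a law outside it is
strictly separated from it by some function `g` on the letters. The extreme rule for `g` picks the
offered letter minimising `g`; integrating the inequalities that define `C` over the superlevel sets
of `g` shows that no law in `C` lies beyond it. With such a rule the output is i.i.d., and random
coding (`exists_codebook_block`) reaches its rate-distortion function.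

The distortion bound must hold for every `n`, not just asymptotically. Short blocks use the full
codebook with the greedy switcher, which has distortion at most `D_min`. For long blocks, mixing in
a small share of the greedy switcher makes the average distortion strictly less than `D > D_min`,
which leaves room for the coding error (`infAchievable_le_rateDist`). At `D_min` the lower bound
needs right-continuity of `R*` and the upper bound only monotonicity of `R(p, ·)`; below `D_min`,
`R(p, D)` is infinite on `C`. The minimum over `C` exists by joint compactness in the law and the
channel. -/

lemma isCompact_channels {α γ : Type*} [Fintype γ] :
    IsCompact {W : α → γ → ℝ | ∀ x, W x ∈ stdSimplex ℝ γ} := by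
  have := isCompact_univ_pi fun _ : α => isCompact_stdSimplex ℝ γ
  convert this using 1
  ext W; simp

/-! ### Mutual information and regularity of the rate-distortion function -/

section Information

variable {α γ : Type*} [Fintype α] [Fintype γ]

/-- The mutual information in nats of a pair with joint law `J`. -/
noncomputable def jointInfo (J : α → γ → ℝ) : ℝ :=
  ∑ x, ∑ y, J x y * Real.log (J x y / ((∑ y', J x y') * ∑ x', J x' y))

lemma mutualInfo_eq_jointInfo (p : α → ℝ) {W : α → γ → ℝ} (hW : ∀ x, ∑ y, W x y = 1) :
    mutualInfo p W = jointInfo (fun x y => p x * W x y) := by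
  unfold mutualInfo jointInfo
  refine Finset.sum_congr rfl fun x _ => Finset.sum_congr rfl fun y _ => ?_
  rw [← Finset.mul_sum, hW x, mul_one]
  by_cases h : p x = 0
  · simp [h]
  · rw [mul_div_mul_left _ _ h]

/-- The form `H(X) + H(Y) - H(X, Y)` is continuous even where entries vanish, because
`Real.negMulLog` is. -/
lemma jointInfo_eq_negMulLog {J : α → γ → ℝ} (hJ : ∀ x y, 0 ≤ J x y) :
    jointInfo J = ∑ x, Real.negMulLog (∑ y, J x y) + ∑ y, Real.negMulLog (∑ x, J x y)
      - ∑ x, ∑ y, Real.negMulLog (J x y) := by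
  have key : ∀ x y, J x y * Real.log (J x y / ((∑ y', J x y') * ∑ x', J x' y)) =
      -(J x y * Real.log (∑ y', J x y')) + -(J x y * Real.log (∑ x', J x' y))
        - Real.negMulLog (J x y) := by
    intro x y
    rcases (hJ x y).eq_or_lt with h | h
    · simp [← h]
    · have h1 : 0 < ∑ y', J x y' :=
        h.trans_le (Finset.single_le_sum (f := fun y => J x y) (fun i _ => hJ x i)
          (Finset.mem_univ y))
      have h2 : 0 < ∑ x', J x' y :=
        h.trans_le (Finset.single_le_sum (f := fun x => J x y) (fun i _ => hJ i y)
          (Finset.mem_univ x))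
      rw [Real.log_div h.ne' (mul_pos h1 h2).ne', Real.log_mul h1.ne' h2.ne', Real.negMulLog]
      ring
  unfold jointInfo
  simp_rw [key, Finset.sum_sub_distrib, Finset.sum_add_distrib]
  congr 2
  · refine Finset.sum_congr rfl fun x _ => ?_
    rw [Finset.sum_neg_distrib, ← Finset.sum_mul, Real.negMulLog, neg_mul]
  · rw [Finset.sum_comm]
    refine Finset.sum_congr rfl fun x _ => ?_
    rw [Finset.sum_neg_distrib, ← Finset.sum_mul, Real.negMulLog, neg_mul]

lemma continuousOn_jointInfo :
    ContinuousOn (jointInfo : (α → γ → ℝ) → ℝ) {J | ∀ x y, 0 ≤ J x y} := by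
  have h : Continuous fun J : α → γ → ℝ =>
      ∑ x, Real.negMulLog (∑ y, J x y) + ∑ y, Real.negMulLog (∑ x, J x y)
      - ∑ x, ∑ y, Real.negMulLog (J x y) := by
    have := Real.continuous_negMulLog
    fun_prop
  exact h.continuousOn.congr fun J hJ => jointInfo_eq_negMulLog hJ

lemma jointInfo_nonneg {J : α → γ → ℝ} (hJ : ∀ x y, 0 ≤ J x y) (h1 : ∑ x, ∑ y, J x y = 1) :
    0 ≤ jointInfo J := by
  -- This is `log t ≥ 1 - 1/t` at the density ratio; the left sides add up to `1 - 1 = 0`.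
  have key : ∀ x y, J x y - (∑ y', J x y') * ∑ x', J x' y ≤
      J x y * Real.log (J x y / ((∑ y', J x y') * ∑ x', J x' y)) := by
    intro x y
    have hx : 0 ≤ ∑ y', J x y' := Finset.sum_nonneg fun i _ => hJ x i
    have hy : 0 ≤ ∑ x', J x' y := Finset.sum_nonneg fun i _ => hJ i y
    rcases (hJ x y).eq_or_lt with h | h
    · rw [← h]; simp only [zero_sub, zero_mul, Left.neg_nonpos_iff]; positivity
    · have h1 : 0 < ∑ y', J x y' :=
        h.trans_le (Finset.single_le_sum (f := fun y => J x y) (fun i _ => hJ x i)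
          (Finset.mem_univ y))
      have h2 : 0 < ∑ x', J x' y :=
        h.trans_le (Finset.single_le_sum (f := fun x => J x y) (fun i _ => hJ i y)
          (Finset.mem_univ x))
      have := Real.one_sub_inv_le_log_of_pos (div_pos h (mul_pos h1 h2))
      have := mul_le_mul_of_nonneg_left this h.le
      refine le_trans (le_of_eq ?_) this
      rw [inv_div, mul_sub, mul_one, mul_div_cancel₀ _ h.ne']
  calc (0 : ℝ) = ∑ x, ∑ y, (J x y - (∑ y', J x y') * ∑ x', J x' y) := by
        simp_rw [Finset.sum_sub_distrib, ← Finset.mul_sum, ← Finset.sum_mul]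
        rw [Finset.sum_comm (f := fun y x => J x y), h1]; ring
    _ ≤ _ := Finset.sum_le_sum fun x _ => Finset.sum_le_sum fun y _ => key x y

/-- A joint law bounds the rate-distortion function of its first marginal. -/
lemma rateDist_le_jointInfo {J : α → γ → ℝ} (hJ : ∀ x y, 0 ≤ J x y) {p : α → ℝ}
    (hJp : ∀ x, ∑ y, J x y = p x) [Nonempty γ] {δ : α → γ → ℝ} {D : ℝ}
    (hD : ∑ x, ∑ y, J x y * δ x y ≤ D) : rateDist p δ D ≤ (jointInfo J : EReal) := by
  classical
  -- Where `p x = 0` the row of `J` vanishes and any law will do; a point mass keeps `W` a channel.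
  set W : α → γ → ℝ := fun x y =>
    if p x = 0 then (if y = Classical.arbitrary γ then 1 else 0) else J x y / p x with hWdef
  have hp : ∀ x, 0 ≤ p x := fun x => hJp x ▸ Finset.sum_nonneg fun y _ => hJ x y
  have hpW : (fun x y => p x * W x y) = J := by
    funext x y
    by_cases h : p x = 0
    · have : J x y ≤ 0 := by
        rw [← h, ← hJp x]
        exact Finset.single_le_sum (f := fun y => J x y) (fun i _ => hJ x i) (Finset.mem_univ y)
      rw [h, zero_mul]; exact (hJ x y).antisymm this
    · simp only [hWdef, h, if_false]; field_simp
  have hW : ∀ x, W x ∈ stdSimplex ℝ γ := by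
    intro x
    by_cases h : p x = 0
    · refine ⟨fun y => ?_, ?_⟩
      · simp only [hWdef, h, if_true]; split_ifs <;> norm_num
      · simp [hWdef, h]
    · refine ⟨fun y => ?_, ?_⟩
      · simp only [hWdef, h, if_false]; exact div_nonneg (hJ x y) (hp x)
      · simp only [hWdef, h, if_false]
        rw [← Finset.sum_div, hJp, div_self h]
  have hfeas : W ∈ feasibleChannels p δ D := by
    refine ⟨hW, ?_⟩
    have := fun x y => congrFun (congrFun hpW x) y
    simpa only [this] using hD
  refine (iInf₂_le W hfeas).trans ?_
  rw [mutualInfo_eq_jointInfo p fun x => (hW x).2, hpW]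

lemma continuousOn_mutualInfo :
    ContinuousOn (fun q : (α → ℝ) × (α → γ → ℝ) => mutualInfo q.1 q.2)
      {q | (∀ x, 0 ≤ q.1 x) ∧ ∀ x, q.2 x ∈ stdSimplex ℝ γ} := by
  have h : ContinuousOn (fun q : (α → ℝ) × (α → γ → ℝ) => jointInfo fun x y => q.1 x * q.2 x y)
      {q | (∀ x, 0 ≤ q.1 x) ∧ ∀ x, q.2 x ∈ stdSimplex ℝ γ} := by
    refine continuousOn_jointInfo.comp (f := fun (q : (α → ℝ) × (α → γ → ℝ)) x y => q.1 x * q.2 x y)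
      (by fun_prop) ?_
    intro q hq x y
    exact mul_nonneg (hq.1 x) ((hq.2 x).1 y)
  exact h.congr fun q hq => mutualInfo_eq_jointInfo _ fun x => (hq.2 x).2

/-- The rate-distortion function attains its minimum over a compact set of source laws. -/
lemma exists_isLeast_rateDist {C : Set (α → ℝ)} (hC : IsCompact C) (hne : C.Nonempty)
    (hpos : ∀ p ∈ C, ∀ x, 0 ≤ p x) (δ : α → γ → ℝ) (D : ℝ) :
    ∃ r, IsLeast ((fun p => rateDist p δ D) '' C) r := by
  -- Minimising over pairs of law and channel at once avoids any semicontinuity of the inner minimum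
  -- in `p`.
  set K : Set ((α → ℝ) × (α → γ → ℝ)) := {q | q.1 ∈ C ∧ q.2 ∈ feasibleChannels q.1 δ D} with hK
  have hKc : IsCompact K := by
    have h1 := hC.prod (isCompact_channels (α := α) (γ := γ))
    have h2 : IsClosed {q : (α → ℝ) × (α → γ → ℝ) | ∑ x, ∑ y, q.1 x * q.2 x y * δ x y ≤ D} :=
      isClosed_le (by fun_prop) continuous_const
    convert h1.inter_right h2 using 1
    ext q
    simp only [hK, feasibleChannels, Set.mem_ofPred_eq, Set.mem_inter_iff, Set.mem_prod]
    tauto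
  rcases K.eq_empty_or_nonempty with h | h
  · obtain ⟨p, hp⟩ := hne
    have htop : ∀ p ∈ C, rateDist p δ D = ⊤ := by
      intro p hp
      unfold rateDist
      refine iInf₂_eq_top.2 fun W hW => ?_
      have : (p, W) ∈ K := ⟨hp, hW⟩
      simp [h] at this
    refine ⟨⊤, ⟨p, hp, htop p hp⟩, ?_⟩
    rintro _ ⟨q, hq, rfl⟩
    simp [htop q hq]
  · obtain ⟨⟨p, W⟩, hpW, hmin⟩ := hKc.exists_isMinOn h
      (continuousOn_mutualInfo.mono fun q hq => ⟨hpos _ hq.1, hq.2.1⟩)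
    have hle : ∀ q ∈ C, (mutualInfo p W : EReal) ≤ rateDist q δ D := fun q hq =>
      le_iInf₂ fun V hV => EReal.coe_le_coe_iff.2 (hmin (show (q, V) ∈ K from ⟨hq, hV⟩))
    refine ⟨mutualInfo p W, ⟨p, hpW.1, le_antisymm (iInf₂_le W hpW.2) (hle p hpW.1)⟩, ?_⟩
    rintro _ ⟨q, hq, rfl⟩
    exact hle q hq

lemma rateDist_antitone (p : α → ℝ) (δ : α → γ → ℝ) : Antitone (rateDist p δ) :=
  fun _ _ h => le_iInf₂ fun W hW => iInf₂_le W ⟨hW.1, hW.2.trans h⟩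

/-- The rate-distortion function is continuous from the right. -/
lemma rateDist_le_iSup_gt {p : α → ℝ} (hp : ∀ x, 0 ≤ p x) (δ : α → γ → ℝ) (D : ℝ) :
    rateDist p δ D ≤ ⨆ D' > D, rateDist p δ D' := by
  refine EReal.le_of_forall_lt_iff_le.1 fun c hc => ?_
  have hex : ∀ D' > D, ∃ W ∈ feasibleChannels p δ D', mutualInfo p W < c := by
    intro D' hD'
    have : rateDist p δ D' < c := (le_iSup₂ (f := fun D' (_ : D' > D) => rateDist p δ D') D'
      hD').trans_lt hc
    obtain ⟨W, hW⟩ := iInf_lt_iff.1 this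
    obtain ⟨hW1, hW2⟩ := iInf_lt_iff.1 hW
    exact ⟨W, hW1, EReal.coe_lt_coe_iff.1 hW2⟩
  have hcont : ContinuousOn (mutualInfo p) {W : α → γ → ℝ | ∀ x, W x ∈ stdSimplex ℝ γ} :=
    continuousOn_mutualInfo.comp (f := fun W : α → γ → ℝ => (p, W)) (by fun_prop)
      fun W hW => ⟨hp, hW⟩
  -- The roles are exchanged: the distortion is minimised over the channels of information at most
  -- `c`. The minimiser beats every `D' > D`, hence meets `D` itself.
  have hcomp : IsCompact ({W : α → γ → ℝ | ∀ x, W x ∈ stdSimplex ℝ γ} ∩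
      mutualInfo p ⁻¹' Set.Iic c) := 
    isCompact_channels.of_isClosed_subset
      (hcont.preimage_isClosed_of_isClosed isCompact_channels.isClosed isClosed_Iic)
      Set.inter_subset_left
  obtain ⟨W₁, hW₁, hI₁⟩ := hex (D + 1) (by simp)
  obtain ⟨W₀, hW₀, hmin⟩ := hcomp.exists_isMinOn ⟨W₁, hW₁.1, hI₁.le⟩
    (f := fun W : α → γ → ℝ => ∑ x, ∑ y, p x * W x y * δ x y) (by fun_prop)
  refine (iInf₂_le W₀ ⟨hW₀.1, ?_⟩).trans (EReal.coe_le_coe_iff.2 hW₀.2)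
  refine le_of_forall_gt_imp_ge_of_dense fun D' hD' => ?_
  obtain ⟨W, hW, hI⟩ := hex D' hD'
  exact (hmin (show W ∈ _ from ⟨hW.1, hI.le⟩)).trans hW.2

end Information

/-! ### Sums against product laws -/

section ProductLaw

variable {ι α β γ : Type*} [Fintype ι] [DecidableEq ι] [Fintype α] [Fintype β] [Fintype γ]

lemma sum_pi_prod (f : ι → α → ℝ) : ∑ x : ι → α, ∏ k, f k (x k) = ∏ k, ∑ a, f k a := by
  rw [Finset.prod_univ_sum, Fintype.piFinset_univ]

lemma sum_prodLaw {p : α → ℝ} (hp : ∑ a, p a = 1) : ∑ x : ι → α, ∏ k, p (x k) = 1 := by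
  rw [sum_pi_prod fun _ => p]; simp [hp]

/-- The expectation of a function of one coordinate under a product law. -/
lemma sum_prodLaw_mul_apply {p : α → ℝ} (hp : ∑ a, p a = 1) (k : ι) (f : α → ℝ) :
    ∑ x : ι → α, (∏ j, p (x j)) * f (x k) = ∑ a, p a * f a := by
  have h : ∀ x : ι → α, (∏ j, p (x j)) * f (x k) =
      ∏ j, (p (x j) * if j = k then f (x j) else 1) := by
    intro x
    rw [Finset.prod_mul_distrib, Finset.prod_ite_eq' Finset.univ k fun j => f (x j)]
    simp
  simp_rw [h]
  rw [sum_pi_prod fun j a => p a * if j = k then f a else 1, Finset.prod_eq_single k]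
  · simp
  · intro j _ hj; simp [hj, hp]
  · simp

/-- The image of a product law under a map applied to each coordinate. -/
lemma sum_prodLaw_comp [DecidableEq β] (h : α → β) (π : α → ℝ) (F : (ι → β) → ℝ) :
    ∑ z : ι → α, (∏ k, π (z k)) * F (fun k => h (z k)) =
      ∑ x : ι → β, (∏ k, ∑ z with h z = x k, π z) * F x := by
  rw [← Finset.sum_fiberwise Finset.univ fun (z : ι → α) k => h (z k)]
  refine Finset.sum_congr rfl fun x _ => ?_
  rw [Finset.prod_univ_sum, Finset.sum_mul]
  refine Finset.sum_congr ?_ fun z hz => ?_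
  · ext z; simp [funext_iff]
  · have : (fun k => h (z k)) = x := by
      funext k
      simpa using Fintype.mem_piFinset.1 hz k
    rw [this]

end ProductLaw

/-! ### Converse for a memoryless source -/

section Converse

variable {α γ : Type*} [Fintype α] [Fintype γ]

/-- The converse of the rate-distortion theorem for a memoryless source. -/
lemma rateDist_le_log_card {p : α → ℝ} (hp : p ∈ stdSimplex ℝ α) (δ : α → γ → ℝ) {D : ℝ}
    {n : ℕ} (hn : n ≠ 0) (B : Codebook γ n)
    (hD : ∑ v : Fin n → α, (∏ k, p (v k)) * codebookDist δ v B ≤ D) :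
    rateDist p δ D ≤ ((Real.log B.1.card / n : ℝ) : EReal) := by
  classical
  have hn0 : (0 : ℝ) < n := by positivity
  have hφ : ∀ v : Fin n → α, ∃ b ∈ B.1, codebookDist δ v B = blockDist δ v b := fun v =>
    Finset.exists_mem_eq_inf' B.2 _
  choose φ hφB hφ using hφ
  have : Nonempty γ := by
    obtain ⟨b, -⟩ := B.2
    exact ⟨b ⟨0, Nat.pos_of_ne_zero hn⟩⟩
  set w : (Fin n → α) → ℝ := fun v => ∏ k, p (v k) with hw
  have hw0 : ∀ v, 0 ≤ w v := fun v => Finset.prod_nonneg fun k _ => hp.1 _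
  have hw1 : ∑ v, w v = 1 := sum_prodLaw hp.2
  -- The joint law of a source letter and its codeword letter at a uniformly chosen time. Its
  -- information is bounded directly by a change of measure, without chain rule or convexity.
  set J : α → γ → ℝ := fun x y =>
    ∑ v, ∑ k, (if v k = x then if φ v k = y then w v / n else 0 else 0) with hJdef
  have hJ0 : ∀ x y, 0 ≤ J x y := fun x y => Finset.sum_nonneg fun v _ => Finset.sum_nonneg
    fun k _ => by have := hw0 v; split_ifs <;> positivity
  have hJE : ∀ f : α → γ → ℝ, ∑ x, ∑ y, J x y * f x y = ∑ v, w v * ((∑ k, f (v k) (φ v k)) / n) := by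
    intro f
    have h1 : ∀ x y, J x y * f x y = ∑ v, ∑ k,
        (if v k = x then if φ v k = y then w v / n * f x y else 0 else 0) := by
      intro x y
      simp only [hJdef, Finset.sum_mul, ite_mul, zero_mul]
    simp_rw [h1]
    calc _ = ∑ x, ∑ v, ∑ y, ∑ k, (if v k = x then if φ v k = y then w v / n * f x y else 0 else 0) :=
          Finset.sum_congr rfl fun x _ => Finset.sum_comm
      _ = ∑ v, ∑ x, ∑ y, ∑ k, (if v k = x then if φ v k = y then w v / n * f x y else 0 else 0) :=
          Finset.sum_comm
      _ = ∑ v, ∑ x, ∑ k, ∑ y, (if v k = x then if φ v k = y then w v / n * f x y else 0 else 0) :=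
          Finset.sum_congr rfl fun v _ => Finset.sum_congr rfl fun x _ => Finset.sum_comm
      _ = ∑ v, ∑ k, ∑ x, ∑ y, (if v k = x then if φ v k = y then w v / n * f x y else 0 else 0) :=
          Finset.sum_congr rfl fun v _ => Finset.sum_comm
      _ = _ := by
          refine Finset.sum_congr rfl fun v _ => ?_
          rw [Finset.sum_div, Finset.mul_sum]
          refine Finset.sum_congr rfl fun k _ => ?_
          rw [Finset.sum_eq_single (v k), Finset.sum_eq_single (φ v k)]
          · simp; ring
          · intro y _ hy; simp [hy.symm]
          · simp
          · intro x _ hx; simp [hx.symm]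
          · simp
  have hJp : ∀ x, ∑ y, J x y = p x := by
    intro x
    have h := hJE fun a _ => if a = x then 1 else 0
    have h2 : ∑ a, ∑ y, J a y * (if a = x then 1 else 0) = ∑ y, J x y := by
      rw [Finset.sum_eq_single x]
      · simp
      · intro a _ ha; simp [ha]
      · simp
    rw [← h2, h]
    calc ∑ v, w v * ((∑ k, if v k = x then (1 : ℝ) else 0) / n)
        = (∑ k : Fin n, ∑ v, w v * (if v k = x then (1 : ℝ) else 0)) / n := by
          rw [Finset.sum_comm, Finset.sum_div]
          refine Finset.sum_congr rfl fun v _ => ?_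
          rw [← Finset.mul_sum, mul_div_assoc]
      _ = (∑ k : Fin n, p x) / n := by
          congr 1
          refine Finset.sum_congr rfl fun k _ => ?_
          rw [sum_prodLaw_mul_apply hp.2 k fun a => if a = x then (1 : ℝ) else 0]
          simp
      _ = p x := by simp; field_simp
  have hJD : ∑ x, ∑ y, J x y * δ x y ≤ D := by
    rw [hJE]
    refine le_trans (le_of_eq ?_) hD
    refine Finset.sum_congr rfl fun v _ => ?_
    rw [hφ v]; rfl
  refine (rateDist_le_jointInfo hJ0 hJp hJD).trans (EReal.coe_le_coe_iff.2 ?_)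
  set q : γ → ℝ := fun y => ∑ x, J x y with hq
  have hq0 : ∀ y, 0 ≤ q y := fun y => Finset.sum_nonneg fun x _ => hJ0 x y
  set R : α → γ → ℝ := fun x y => J x y / (p x * q y) with hR
  have hR0 : ∀ x y, 0 ≤ R x y := fun x y => div_nonneg (hJ0 x y) (mul_nonneg (hp.1 x) (hq0 y))
  have hI : jointInfo J = (∑ v, w v * ∑ k, Real.log (R (v k) (φ v k))) / n := by
    have : jointInfo J = ∑ x, ∑ y, J x y * Real.log (R x y) := by
      unfold jointInfo
      simp only [hJp, hR, hq]
    rw [this, hJE fun x y => Real.log (R x y), Finset.sum_div]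
    exact Finset.sum_congr rfl fun v _ => by rw [mul_div_assoc]
  rw [hI, div_le_div_iff_of_pos_right hn0]
  set c : ℝ := ((B.1.card : ℕ) : ℝ) with hc
  have hc0 : 0 < c := by rw [hc]; exact_mod_cast B.2.card_pos
  -- `log t ≤ t - 1` with `t = (∏ R) / c`, where `c` is the size of the codebook. Blocks of weight
  -- zero are set apart because `R` may vanish there.
  have hpt : ∀ v, w v * ∑ k, Real.log (R (v k) (φ v k)) ≤
      w v * ((∏ k, R (v k) (φ v k)) / c - 1 + Real.log c) := by
    intro v
    rcases (hw0 v).eq_or_lt with h | h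
    · simp [← h]
    · have hpv : ∀ k, 0 < p (v k) := fun k => (hp.1 _).lt_of_ne' fun h0 =>
        h.ne' (Finset.prod_eq_zero (Finset.mem_univ k) h0)
      have hJv : ∀ k, 0 < J (v k) (φ v k) := by
        intro k
        have hnn : ∀ u j, 0 ≤ (if u j = v k then if φ u j = φ v k then w u / n else 0 else 0) :=
          fun u j => by have := hw0 u; split_ifs <;> positivity
        calc 0 < w v / n := div_pos h hn0
          _ = (if v k = v k then if φ v k = φ v k then w v / n else 0 else 0) := by simp
          _ ≤ ∑ j, (if v j = v k then if φ v j = φ v k then w v / n else 0 else 0) :=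
            Finset.single_le_sum (f := fun j => if v j = v k then
              if φ v j = φ v k then w v / n else 0 else 0) (fun j _ => hnn v j) (Finset.mem_univ k)
          _ ≤ J (v k) (φ v k) :=
            Finset.single_le_sum (f := fun u => ∑ j, if u j = v k then
              if φ u j = φ v k then w u / n else 0 else 0)
              (fun u _ => Finset.sum_nonneg fun j _ => hnn u j) (Finset.mem_univ v)
      have hRv : ∀ k, 0 < R (v k) (φ v k) := fun k => div_pos (hJv k) (mul_pos (hpv k)
        ((hJv k).trans_le (Finset.single_le_sum (f := fun x => J x (φ v k)) (fun x _ => hJ0 x _)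
          (Finset.mem_univ (v k)))))
      refine mul_le_mul_of_nonneg_left ?_ h.le
      have hprod : 0 < ∏ k, R (v k) (φ v k) := Finset.prod_pos fun k _ => hRv k
      rw [← Real.log_prod fun k _ => (hRv k).ne']
      have := Real.log_le_sub_one_of_pos (div_pos hprod hc0)
      rw [Real.log_div hprod.ne' hc0.ne'] at this
      linarith
  -- Only an inequality: the column is zero when `q y = 0`.
  have hcol : ∀ y, ∑ x, p x * R x y ≤ 1 := by
    intro y
    calc ∑ x, p x * R x y ≤ ∑ x, J x y / q y := by
          refine Finset.sum_le_sum fun x _ => ?_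
          rcases (hp.1 x).eq_or_lt with h | h
          · rw [← h, zero_mul]; exact div_nonneg (hJ0 x y) (hq0 y)
          · simp only [hR]; rw [div_mul_eq_div_div_swap, mul_div_cancel₀ _ h.ne']
      _ ≤ 1 := by rw [← Finset.sum_div]; exact div_self_le_one _
  -- Bounding the term of the chosen codeword by the sum over all codewords removes the dependence
  -- on `v`, so that each summand factorises over time.
  have hsum : ∑ v, w v * ∏ k, R (v k) (φ v k) ≤ c := by
    calc ∑ v, w v * ∏ k, R (v k) (φ v k) ≤ ∑ v, ∑ b ∈ B.1, w v * ∏ k, R (v k) (b k) := by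
          refine Finset.sum_le_sum fun v _ => ?_
          exact Finset.single_le_sum (f := fun b : Fin n → γ => w v * ∏ k, R (v k) (b k))
            (fun b _ => mul_nonneg (hw0 v) (Finset.prod_nonneg fun k _ => hR0 _ _)) (hφB v)
      _ = ∑ b ∈ B.1, ∏ k, ∑ x, p x * R x (b k) := by
          rw [Finset.sum_comm]
          refine Finset.sum_congr rfl fun b _ => ?_
          rw [← sum_pi_prod fun k x => p x * R x (b k)]
          exact Finset.sum_congr rfl fun v _ => Finset.prod_mul_distrib.symm
      _ ≤ ∑ b ∈ B.1, 1 := Finset.sum_le_sum fun b _ => Finset.prod_le_one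
          (fun k _ => Finset.sum_nonneg fun x _ => mul_nonneg (hp.1 x) (hR0 _ _)) fun k _ => hcol _
      _ = c := by simp [hc]
  calc ∑ v, w v * ∑ k, Real.log (R (v k) (φ v k))
      ≤ ∑ v, w v * ((∏ k, R (v k) (φ v k)) / c - 1 + Real.log c) :=
        Finset.sum_le_sum fun v _ => hpt v
    _ = (∑ v, w v * ∏ k, R (v k) (φ v k)) / c + (Real.log c - 1) * ∑ v, w v := by
        rw [Finset.sum_div, Finset.mul_sum, ← Finset.sum_add_distrib]
        exact Finset.sum_congr rfl fun v _ => by ring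
    _ ≤ Real.log c := by
        rw [hw1]
        have := (div_le_one hc0).2 hsum
        linarith

end Converse

/-! ### One-shot random coding and the weak law -/

section RandomCoding

/-- One-shot random coding: a codebook of at most `M` words drawn independently from the output
law. -/
lemma exists_codebook_oneShot {A C : Type*} [Fintype A] [Fintype C] [Nonempty C]
    {J : A → C → ℝ} (hJ0 : ∀ x y, 0 ≤ J x y) (hJ1 : ∑ x, ∑ y, J x y = 1) {Δ : A → C → ℝ} {K t a : ℝ}
    (hΔ : ∀ x y, Δ x y ≤ K) (hK : 0 ≤ K) (ht : 0 ≤ t) (T : A → C → Prop)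
    [∀ x y, Decidable (T x y)]
    (hT : ∀ x y, T x y → Δ x y ≤ t ∧ J x y ≤ Real.exp a * ((∑ y', J x y') * ∑ x', J x' y))
    {M : ℕ} (hM : 0 < M) :
    ∃ (B : Finset C) (hB : B.Nonempty), B.card ≤ M ∧
      ∑ x, (∑ y, J x y) * B.inf' hB (Δ x) ≤
        t + K * (∑ x, ∑ y, (if T x y then 0 else J x y) + Real.exp (-(M * Real.exp (-a)))) := by
  classical
  have : Nonempty (Fin M) := ⟨⟨0, hM⟩⟩
  set p : A → ℝ := fun x => ∑ y, J x y with hp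
  set q : C → ℝ := fun y => ∑ x, J x y with hq
  have hp0 : ∀ x, 0 ≤ p x := fun x => Finset.sum_nonneg fun y _ => hJ0 x y
  have hq0 : ∀ y, 0 ≤ q y := fun y => Finset.sum_nonneg fun x _ => hJ0 x y
  have hp1 : ∑ x, p x = 1 := hJ1
  have hq1 : ∑ y, q y = 1 := by rw [← hJ1]; exact Finset.sum_comm
  set u : A → ℝ := fun x => ∑ y, (if T x y then J x y else 0) with hu
  have hu0 : ∀ x, 0 ≤ u x := fun x => Finset.sum_nonneg fun y _ => by
    split_ifs
    exacts [hJ0 x y, le_rfl]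
  have hup : ∀ x, u x ≤ p x := fun x => Finset.sum_le_sum fun y _ => by
    split_ifs
    exacts [le_rfl, hJ0 x y]
  set bad : A → C → ℝ := fun x y => if Δ x y ≤ t then 0 else 1 with hbad
  have hbad0 : ∀ x y, 0 ≤ bad x y := fun x y => by simp only [hbad]; split_ifs <;> norm_num
  set κ : ℝ := M * Real.exp (-a) with hκ
  have hrow : ∀ x, p x * (∑ y, q y * bad x y) ^ M ≤ p x - u x + p x * Real.exp (-κ) := by
    intro x
    rcases (hp0 x).eq_or_lt with h | h
    · have : u x = 0 := le_antisymm (h ▸ hup x) (hu0 x)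
      rw [← h, this]; simp
    set v : ℝ := u x / p x with hv
    have hv0 : 0 ≤ v := div_nonneg (hu0 x) h.le
    have hv1 : v ≤ 1 := (div_le_one h).2 (hup x)
    have hbadle : ∑ y, q y * bad x y ≤ 1 - Real.exp (-a) * v := by
      -- On `T` the output law satisfies `q y ≥ exp (-a) * J x y / p x`, so one random word is good
      -- for `x` with probability at least `exp (-a) * v`.
      have h1 : Real.exp (-a) * v ≤ ∑ y, q y * (1 - bad x y) := by
        rw [hv, ← mul_div_assoc, div_le_iff₀ h, hu, Finset.mul_sum, Finset.sum_mul]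
        refine Finset.sum_le_sum fun y _ => ?_
        split_ifs with hTxy
        · have h2 := hT x y hTxy
          have h3 := mul_le_mul_of_nonneg_left h2.2 (Real.exp_pos (-a)).le
          rw [← mul_assoc, ← Real.exp_add, neg_add_cancel, Real.exp_zero, one_mul] at h3
          simp only [hbad, h2.1, if_true, sub_zero, mul_one]
          rw [mul_comm (q y)]; exact h3
        · rw [mul_zero]
          have : 0 ≤ 1 - bad x y := by simp only [hbad]; split_ifs <;> norm_num
          exact mul_nonneg (mul_nonneg (hq0 y) this) h.le
      simp_rw [mul_sub, Finset.sum_sub_distrib, mul_one, hq1] at h1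
      linarith
    have hpow : (∑ y, q y * bad x y) ^ M ≤ 1 - v + Real.exp (-κ) := by
      calc (∑ y, q y * bad x y) ^ M ≤ (Real.exp (-(Real.exp (-a) * v))) ^ M := by
            refine pow_le_pow_left₀ (Finset.sum_nonneg fun y _ => mul_nonneg (hq0 y) (hbad0 x y))
              (hbadle.trans ?_) M
            have := Real.add_one_le_exp (-(Real.exp (-a) * v))
            linarith
        -- The exponent is `-κ * v`, a convex combination of `0` and `-κ`; convexity of `exp`
        -- separates the failure of `T` from the failure to draw a good word.
        _ = Real.exp ((1 - v) • (0 : ℝ) + v • (-κ)) := by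
            rw [← Real.exp_nat_mul]
            congr 1
            simp only [hκ, smul_eq_mul]
            ring
        _ ≤ (1 - v) • Real.exp 0 + v • Real.exp (-κ) :=
            convexOn_exp.2 (Set.mem_univ _) (Set.mem_univ _) (by linarith) hv0 (by ring)
        _ ≤ 1 - v + Real.exp (-κ) := by
            rw [Real.exp_zero, smul_eq_mul, smul_eq_mul, mul_one]
            have := mul_le_of_le_one_left (Real.exp_pos (-κ)).le hv1
            linarith
    have h4 := mul_le_mul_of_nonneg_left hpow h.le
    have h5 : p x * v = u x := by rw [hv, mul_div_cancel₀ _ h.ne']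
    nlinarith
  set F : (Fin M → C) → ℝ := fun c =>
    ∑ x, p x * (Finset.univ.image c).inf' (Finset.univ_nonempty.image c) (Δ x) with hF
  obtain ⟨c, -, hc⟩ := Finset.exists_min_image Finset.univ F Finset.univ_nonempty
  refine ⟨Finset.univ.image c, Finset.univ_nonempty.image c, ?_, ?_⟩
  · exact Finset.card_image_le.trans (by simp)
  change F c ≤ _
  have hw0 : ∀ c : Fin M → C, 0 ≤ ∏ j, q (c j) := fun c => Finset.prod_nonneg fun j _ => hq0 _
  have hw1 : ∑ c : Fin M → C, ∏ j, q (c j) = 1 := sum_prodLaw hq1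
  have hFle : ∀ c, F c ≤ t + K * ∑ x, p x * ∏ j, bad x (c j) := by
    intro c
    have h1 : ∀ x, (Finset.univ.image c).inf' (Finset.univ_nonempty.image c) (Δ x) ≤
        t + K * ∏ j, bad x (c j) := by
      intro x
      by_cases h : ∃ j, Δ x (c j) ≤ t
      · obtain ⟨j, hj⟩ := h
        refine (Finset.inf'_le _ (Finset.mem_image_of_mem c (Finset.mem_univ j))).trans
          (hj.trans ?_)
        have := mul_nonneg hK (Finset.prod_nonneg fun j (_ : j ∈ Finset.univ) => hbad0 x (c j))
        linarith
      · push Not at h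
        refine (Finset.inf'_le _ (Finset.mem_image_of_mem c
          (Finset.mem_univ (Classical.arbitrary _)))).trans ((hΔ _ _).trans ?_)
        have : ∏ j, bad x (c j) = 1 := Finset.prod_eq_one fun j _ => if_neg (h j).not_ge
        rw [this]; linarith
    calc F c ≤ ∑ x, p x * (t + K * ∏ j, bad x (c j)) :=
          Finset.sum_le_sum fun x _ => mul_le_mul_of_nonneg_left (h1 x) (hp0 x)
      _ = (∑ x, p x) * t + K * ∑ x, p x * ∏ j, bad x (c j) := by
          rw [Finset.sum_mul, Finset.mul_sum, ← Finset.sum_add_distrib]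
          exact Finset.sum_congr rfl fun x _ => by ring
      _ = _ := by rw [hp1, one_mul]
  -- The best codebook is no worse than the average over words drawn independently from `q`.
  calc F c = ∑ c' : Fin M → C, (∏ j, q (c' j)) * F c := by rw [← Finset.sum_mul, hw1, one_mul]
    _ ≤ ∑ c' : Fin M → C, (∏ j, q (c' j)) * (t + K * ∑ x, p x * ∏ j, bad x (c' j)) :=
        Finset.sum_le_sum fun c' _ => mul_le_mul_of_nonneg_left
          ((hc c' (Finset.mem_univ _)).trans (hFle c')) (hw0 c')
    _ = (∑ c' : Fin M → C, ∏ j, q (c' j)) * t +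
          K * ∑ x, p x * ∑ c' : Fin M → C, ∏ j, (q (c' j) * bad x (c' j)) := by
        simp_rw [Finset.prod_mul_distrib, Finset.mul_sum, Finset.sum_mul]
        rw [Finset.sum_comm (s := (Finset.univ : Finset A)), ← Finset.sum_add_distrib]
        refine Finset.sum_congr rfl fun c' _ => ?_
        rw [mul_add, Finset.mul_sum]
        congr 1
        exact Finset.sum_congr rfl fun x _ => by ring
    _ = t + K * ∑ x, p x * (∑ y, q y * bad x y) ^ M := by
        rw [hw1, one_mul]
        congr 2
        refine Finset.sum_congr rfl fun x _ => ?_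
        rw [sum_pi_prod fun _ y => q y * bad x y]
        simp
    _ ≤ t + K * ∑ x, (p x - u x + p x * Real.exp (-κ)) := by
        gcongr with x _
        exact hrow x
    _ = _ := by
        rw [Finset.sum_add_distrib, ← Finset.sum_mul, hp1, one_mul]
        congr 3
        refine Finset.sum_congr rfl fun x _ => ?_
        rw [hp, hu, ← Finset.sum_sub_distrib]
        exact Finset.sum_congr rfl fun y _ => by split_ifs <;> ring

variable {ζ : Type*} [Fintype ζ]

/-- The variance of a sum of independent identically distributed centred variables. -/
lemma sum_prodLaw_mul_sq {π : ζ → ℝ} (hπ : ∑ z, π z = 1) {g : ζ → ℝ}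
    (hg : ∑ z, π z * g z = 0) (n : ℕ) :
    ∑ z : Fin n → ζ, (∏ k, π (z k)) * (∑ k, g (z k)) ^ 2 = n * ∑ z, π z * g z ^ 2 := by
  classical
  have h1 : ∀ z : Fin n → ζ, (∏ k, π (z k)) * (∑ k, g (z k)) ^ 2 =
      ∑ i, ∑ j, (∏ k, π (z k)) * (g (z i) * g (z j)) := by
    intro z
    rw [sq, Finset.sum_mul_sum, Finset.mul_sum]
    exact Finset.sum_congr rfl fun i _ => Finset.mul_sum ..
  have h2 : ∀ i j : Fin n, ∑ z : Fin n → ζ, (∏ k, π (z k)) * (g (z i) * g (z j)) =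
      if i = j then ∑ z, π z * g z ^ 2 else 0 := by
    intro i j
    split_ifs with hij
    · subst hij
      rw [← sum_prodLaw_mul_apply hπ i fun z => g z ^ 2]
      exact Finset.sum_congr rfl fun z _ => by rw [sq]
    · have h3 : ∀ z : Fin n → ζ, (∏ k, π (z k)) * (g (z i) * g (z j)) =
          ∏ k, (π (z k) * ((if k = i then g (z k) else 1) * if k = j then g (z k) else 1)) := by
        intro z
        rw [Finset.prod_mul_distrib, Finset.prod_mul_distrib,
          Finset.prod_ite_eq' Finset.univ i fun k => g (z k),
          Finset.prod_ite_eq' Finset.univ j fun k => g (z k)]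
        simp
      simp_rw [h3]
      rw [sum_pi_prod fun k a => π a * ((if k = i then g a else 1) * if k = j then g a else 1)]
      refine Finset.prod_eq_zero (Finset.mem_univ i) ?_
      simpa [hij] using hg
  simp_rw [h1]
  rw [Finset.sum_comm]
  have h4 : ∀ i : Fin n, ∑ z : Fin n → ζ, ∑ j, (∏ k, π (z k)) * (g (z i) * g (z j)) =
      ∑ z, π z * g z ^ 2 := by
    intro i
    rw [Finset.sum_comm]
    simp_rw [h2]
    simp
  simp_rw [h4]
  simp

/-- The weak law of large numbers, one-sided, from Chebyshev's inequality. -/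
lemma sum_prodLaw_tail_le {π : ζ → ℝ} (hπ : π ∈ stdSimplex ℝ ζ) (g : ζ → ℝ) {s : ℝ}
    (hs : ∑ z, π z * g z < s) :
    ∃ C : ℝ, ∀ n : ℕ, 0 < n →
      ∑ z : Fin n → ζ, (if n * s < ∑ k, g (z k) then ∏ k, π (z k) else 0) ≤ C / n := by
  set μ := ∑ z, π z * g z with hμ
  set V := ∑ z, π z * (g z - μ) ^ 2 with hV
  refine ⟨V / (s - μ) ^ 2, fun n hn => ?_⟩
  have hn0 : (0 : ℝ) < n := by exact_mod_cast hn
  have hsμ : 0 < s - μ := sub_pos.2 hs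
  have hpi : ∀ z : Fin n → ζ, 0 ≤ ∏ k, π (z k) := fun z => Finset.prod_nonneg fun k _ => hπ.1 _
  have hvar := sum_prodLaw_mul_sq (π := π) hπ.2 (g := fun z => g z - μ)
    (by simp_rw [mul_sub, Finset.sum_sub_distrib, ← Finset.sum_mul, hπ.2]; simp [hμ]) n
  have hpt : ∀ z : Fin n → ζ, (if n * s < ∑ k, g (z k) then ∏ k, π (z k) else 0) ≤
      ((∏ k, π (z k)) * (∑ k, (g (z k) - μ)) ^ 2) / (n * (s - μ)) ^ 2 := by
    intro z
    split_ifs with h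
    · rw [le_div_iff₀ (by positivity)]
      refine mul_le_mul_of_nonneg_left (pow_le_pow_left₀ (by positivity) ?_ 2) (hpi z)
      rw [Finset.sum_sub_distrib]
      simp
      linarith
    · exact div_nonneg (mul_nonneg (hpi z) (sq_nonneg _)) (sq_nonneg _)
  calc _ ≤ ∑ z : Fin n → ζ, ((∏ k, π (z k)) * (∑ k, (g (z k) - μ)) ^ 2) / (n * (s - μ)) ^ 2 :=
        Finset.sum_le_sum fun z _ => hpt z
    _ = n * V / (n * (s - μ)) ^ 2 := by rw [← Finset.sum_div, hvar]
    _ = V / (s - μ) ^ 2 / n := by field_simp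

end RandomCoding

/-! ### Direct part for blocks -/

section BlockCoding

variable {α γ : Type*} [Fintype α] [Fintype γ]

/-- The direct part of the rate-distortion theorem for a memoryless source, in terms of the joint
law of source and reconstruction letters. -/
lemma exists_codebook_block {J : α → γ → ℝ} (hJ0 : ∀ x y, 0 ≤ J x y) (hJ1 : ∑ x, ∑ y, J x y = 1)
    {δ : α → γ → ℝ} (hδ : ∀ x y, 0 ≤ δ x y) {D a : ℝ} (hD : ∑ x, ∑ y, J x y * δ x y < D)
    (ha : jointInfo J < a) :
    ∀ᶠ n : ℕ in atTop, ∀ M : ℕ, Real.exp (n * a) ≤ M → ∃ B : Codebook γ n, B.1.card ≤ M ∧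
      ∑ x : Fin n → α, (∏ k, ∑ y, J (x k) y) * codebookDist δ x B ≤ D := by
  classical
  set E := ∑ x, ∑ y, J x y * δ x y with hE
  -- The gap from `E` to `t` and from the information to `b` serves the weak law; `t < D` absorbs
  -- the error terms, and `b < a` makes the expected number of suitable words, at least `exp (n * (a
  -- - b))`, diverge.
  obtain ⟨t, hEt, htD⟩ := exists_between hD
  obtain ⟨b, hIb, hba⟩ := exists_between ha
  set i : α → γ → ℝ := fun x y => Real.log (J x y / ((∑ y', J x y') * ∑ x', J x' y)) with hi
  set π : α × γ → ℝ := fun z => J z.1 z.2 with hπ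
  have hπmem : π ∈ stdSimplex ℝ (α × γ) :=
    ⟨fun z => hJ0 _ _, by rw [← hJ1, Fintype.sum_prod_type]⟩
  obtain ⟨C₁, hC₁⟩ := sum_prodLaw_tail_le hπmem (fun z => δ z.1 z.2) (s := t)
    (by rw [Fintype.sum_prod_type]; exact hEt)
  obtain ⟨C₂, hC₂⟩ := sum_prodLaw_tail_le hπmem (fun z => i z.1 z.2) (s := b)
    (by rw [Fintype.sum_prod_type]; exact hIb)
  set K := ∑ x, ∑ y, δ x y with hK
  have hK0 : 0 ≤ K := Finset.sum_nonneg fun x _ => Finset.sum_nonneg fun y _ => hδ x y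
  have hδK : ∀ x y, δ x y ≤ K := fun x y =>
    (Finset.single_le_sum (f := fun y => δ x y) (fun y _ => hδ x y) (Finset.mem_univ y)).trans
      (Finset.single_le_sum (f := fun x => ∑ y, δ x y)
        (fun x _ => Finset.sum_nonneg fun y _ => hδ x y) (Finset.mem_univ x))
  have hE0 : 0 ≤ E := Finset.sum_nonneg fun x _ => Finset.sum_nonneg fun y _ =>
    mul_nonneg (hJ0 x y) (hδ x y)
  have : Nonempty γ := by
    by_contra h
    rw [not_nonempty_iff] at h
    simp at hJ1
  have hlim : Tendsto (fun n : ℕ => t + K * ((C₁ / n + C₂ / n) +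
      Real.exp (-Real.exp (n * (a - b))))) atTop (𝓝 (t + K * ((0 + 0) + 0))) := by
    refine tendsto_const_nhds.add (tendsto_const_nhds.mul (((tendsto_const_div_atTop_nhds_zero_nat
      C₁).add (tendsto_const_div_atTop_nhds_zero_nat C₂)).add ?_))
    exact Real.tendsto_exp_neg_atTop_nhds_zero.comp (Real.tendsto_exp_atTop.comp
      (tendsto_natCast_atTop_atTop.atTop_mul_const (sub_pos.2 hba)))
  have hev := hlim.eventually (gt_mem_nhds (by simpa using htD : t + K * ((0 + 0) + 0) < D))
  filter_upwards [hev, eventually_gt_atTop 0] with n hn hn0 M hM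
  have hnR : (0 : ℝ) < n := by exact_mod_cast hn0
  have hM0 : 0 < M := by
    have : (0 : ℝ) < M := (Real.exp_pos _).trans_le hM
    exact_mod_cast this
  have hrowm : ∀ x : Fin n → α, ∑ y : Fin n → γ, ∏ k, J (x k) (y k) = ∏ k, ∑ y, J (x k) y :=
    fun x => sum_pi_prod fun k y => J (x k) y
  have hcolm : ∀ y : Fin n → γ, ∑ x : Fin n → α, ∏ k, J (x k) (y k) = ∏ k, ∑ x, J x (y k) :=
    fun y => sum_pi_prod fun k x => J x (y k)
  set T : (Fin n → α) → (Fin n → γ) → Prop := fun x y => blockDist δ x y ≤ t ∧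
    ∏ k, J (x k) (y k) ≤ Real.exp (n * b) *
      ((∑ y' : Fin n → γ, ∏ k, J (x k) (y' k)) * ∑ x' : Fin n → α, ∏ k, J (x' k) (y k)) with hTdef
  have hJn0 : ∀ (x : Fin n → α) (y : Fin n → γ), 0 ≤ ∏ k, J (x k) (y k) := fun x y =>
    Finset.prod_nonneg fun k _ => hJ0 _ _
  obtain ⟨B, hB, hBM, hBD⟩ := exists_codebook_oneShot
    (J := fun (x : Fin n → α) (y : Fin n → γ) => ∏ k, J (x k) (y k)) hJn0
    (by
      simp_rw [hrowm]
      exact sum_prodLaw (p := fun x => ∑ y, J x y) hJ1)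
    (Δ := fun x y => blockDist δ x y) (K := K) (t := t) (a := n * b)
    (fun x y => by
      rw [blockDist, div_le_iff₀ hnR]
      refine (Finset.sum_le_sum fun k _ => hδK (x k) (y k)).trans ?_
      simp [mul_comm])
    hK0 (hE0.trans hEt.le) T (fun x y h => h) hM0
  refine ⟨⟨B, hB⟩, hBM, ?_⟩
  simp_rw [hrowm] at hBD
  refine (hBD.trans ?_).trans hn.le
  have hTc : ∑ x : Fin n → α, ∑ y : Fin n → γ, (if T x y then 0 else ∏ k, J (x k) (y k)) ≤
      C₁ / n + C₂ / n := by
    have hpt : ∀ (x : Fin n → α) (y : Fin n → γ), (if T x y then 0 else ∏ k, J (x k) (y k)) ≤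
        (if n * t < ∑ k, δ (x k) (y k) then ∏ k, J (x k) (y k) else 0) +
        (if n * b < ∑ k, i (x k) (y k) then ∏ k, J (x k) (y k) else 0) := by
      intro x y
      have hn1 : 0 ≤ (if n * t < ∑ k, δ (x k) (y k) then ∏ k, J (x k) (y k) else 0) := by
        split_ifs
        exacts [hJn0 x y, le_rfl]
      have hn2 : 0 ≤ (if n * b < ∑ k, i (x k) (y k) then ∏ k, J (x k) (y k) else 0) := by
        split_ifs
        exacts [hJn0 x y, le_rfl]
      by_cases hT : T x y
      · rw [if_pos hT]; exact add_nonneg hn1 hn2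
      rw [if_neg hT]
      rcases (hJn0 x y).eq_or_lt with h0 | h0
      · rw [← h0]; simp
      by_cases h1 : n * t < ∑ k, δ (x k) (y k)
      · rw [if_pos h1]; linarith
      by_cases h2 : n * b < ∑ k, i (x k) (y k)
      · rw [if_pos h2]; linarith
      refine absurd ⟨?_, ?_⟩ hT
      · rw [blockDist, div_le_iff₀ hnR, mul_comm]; exact not_lt.1 h1
      · have hJk : ∀ k, 0 < J (x k) (y k) := fun k => (hJ0 _ _).lt_of_ne' fun h =>
          h0.ne' (Finset.prod_eq_zero (Finset.mem_univ k) h)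
        have hpk : ∀ k, 0 < ∑ y', J (x k) y' := fun k => (hJk k).trans_le
          (Finset.single_le_sum (f := fun y' => J (x k) y') (fun _ _ => hJ0 _ _)
            (Finset.mem_univ (y k)))
        have hqk : ∀ k, 0 < ∑ x', J x' (y k) := fun k => (hJk k).trans_le
          (Finset.single_le_sum (f := fun x' => J x' (y k)) (fun _ _ => hJ0 _ _)
            (Finset.mem_univ (x k)))
        rw [hrowm, hcolm, ← Finset.prod_mul_distrib,
          ← div_le_iff₀ (Finset.prod_pos fun k _ => mul_pos (hpk k) (hqk k)),
          ← Finset.prod_div_distrib]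
        have hle := Real.exp_le_exp.2 (not_lt.1 h2)
        rw [Real.exp_sum] at hle
        refine le_trans (le_of_eq (Finset.prod_congr rfl fun k _ => ?_)) hle
        rw [Real.exp_log (div_pos (hJk k) (mul_pos (hpk k) (hqk k)))]
    have hpair : ∀ F : (Fin n → α) → (Fin n → γ) → ℝ, ∑ x, ∑ y, F x y =
        ∑ z : Fin n → α × γ, F (fun k => (z k).1) (fun k => (z k).2) := by
      intro F
      rw [← Fintype.sum_prod_type' F]
      exact (Fintype.sum_equiv (Equiv.arrowProdEquivProdArrow (Fin n) (fun _ => α) (fun _ => γ))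
        _ _ fun z => rfl).symm
    refine (Finset.sum_le_sum fun x _ => Finset.sum_le_sum fun y _ => hpt x y).trans ?_
    simp_rw [Finset.sum_add_distrib]
    rw [hpair, hpair]
    exact add_le_add (hC₁ n hn0) (hC₂ n hn0)
  have hexp : Real.exp (-(M * Real.exp (-(n * b)))) ≤ Real.exp (-Real.exp (n * (a - b))) := by
    refine Real.exp_le_exp.2 (neg_le_neg ?_)
    calc Real.exp (n * (a - b)) = Real.exp (n * a) * Real.exp (-(n * b)) := by
          rw [← Real.exp_add]; congr 1; ring
      _ ≤ _ := mul_le_mul_of_nonneg_right hM (Real.exp_pos _).le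
  gcongr

end BlockCoding

/-! ### Switching rules and the laws they simulate -/

section PureSwitch

variable {X : Type*} {m : ℕ}

/-- The deterministic switching rule that selects position `s x`. -/
def pureSwitch (s : (Fin m → X) → Fin m) (x : Fin m → X) (l : Fin m) : ℝ :=
  if l = s x then 1 else 0

lemma pureSwitch_mem (s : (Fin m → X) → Fin m) (x : Fin m → X) :
    pureSwitch s x ∈ stdSimplex ℝ (Fin m) :=
  ⟨fun l => by unfold pureSwitch; split_ifs <;> norm_num, by simp [pureSwitch]⟩

lemma exists_argmin_switch (hm : 1 ≤ m) (g : X → ℝ) :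
    ∃ s : (Fin m → X) → Fin m, ∀ (x : Fin m → X) (l : Fin m), g (x (s x)) ≤ g (x l) := by
  have : Nonempty (Fin m) := ⟨⟨0, hm⟩⟩
  have h : ∀ x : Fin m → X, ∃ k, ∀ l, g (x k) ≤ g (x l) := fun x => by
    obtain ⟨k, -, hk⟩ := Finset.exists_min_image Finset.univ (fun l => g (x l))
      Finset.univ_nonempty
    exact ⟨k, fun l => hk l (Finset.mem_univ l)⟩
  exact ⟨fun x => (h x).choose, fun x => (h x).choose_spec⟩

end PureSwitch

section Simulation

variable {X : Type*} [Fintype X] [DecidableEq X] {m : ℕ}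

/-- The law of the letter output by a switcher that draws the switch position from `f x` when the
subsources emit `x`. -/
def switchLaw (P : (Fin m → X) → ℝ) (f : (Fin m → X) → Fin m → ℝ) (a : X) : ℝ :=
  ∑ x, P x * ∑ l, if x l = a then f x l else 0

lemma sum_switchLaw_mul (P : (Fin m → X) → ℝ) (f : (Fin m → X) → Fin m → ℝ) (g : X → ℝ) :
    ∑ a, switchLaw P f a * g a = ∑ x, P x * ∑ l, f x l * g (x l) := by
  unfold switchLaw
  simp_rw [Finset.sum_mul]
  rw [Finset.sum_comm]
  refine Finset.sum_congr rfl fun x _ => ?_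
  simp_rw [mul_assoc, ← Finset.mul_sum, Finset.sum_mul, ite_mul, zero_mul]
  rw [Finset.sum_comm]
  simp

lemma switchLaw_nonneg {P : (Fin m → X) → ℝ} (hP : P ∈ stdSimplex ℝ (Fin m → X))
    {f : (Fin m → X) → Fin m → ℝ} (hf : ∀ x, f x ∈ stdSimplex ℝ (Fin m)) (a : X) :
    0 ≤ switchLaw P f a :=
  Finset.sum_nonneg fun x _ => mul_nonneg (hP.1 x) <| Finset.sum_nonneg fun l _ => by
    split_ifs
    exacts [(hf x).1 l, le_rfl]

lemma sum_switchLaw {P : (Fin m → X) → ℝ} (hP : P ∈ stdSimplex ℝ (Fin m → X))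
    {f : (Fin m → X) → Fin m → ℝ} (hf : ∀ x, f x ∈ stdSimplex ℝ (Fin m)) :
    ∑ a, switchLaw P f a = 1 := by
  have := sum_switchLaw_mul P f fun _ => 1
  simp only [mul_one, (hf _).2] at this
  rw [this, hP.2]

lemma sum_switchLaw_pureSwitch_mul (P : (Fin m → X) → ℝ) (s : (Fin m → X) → Fin m) (g : X → ℝ) :
    ∑ a, switchLaw P (pureSwitch s) a * g a = ∑ x, P x * g (x (s x)) := by
  rw [sum_switchLaw_mul]
  simp [pureSwitch]

lemma integral_indicator_le {c b M : ℝ} (hb : b ∈ Set.Icc c M) :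
    ∫ t in c..M, Set.indicator {t | t ≤ b} (fun _ => (1 : ℝ)) t = b - c := by
  rw [intervalIntegral.integral_indicator hb]; simp

lemma intervalIntegrable_indicator_le (c b M : ℝ) : IntervalIntegrable
    (fun t => Set.indicator {t | t ≤ b} (fun _ => (1 : ℝ)) t) MeasureTheory.volume c M := by
  refine Antitone.intervalIntegrable fun t u htu => ?_
  simp only [Set.indicator_apply, Set.mem_ofPred_eq]
  split_ifs <;> linarith

/-- No law in `C` has a smaller mean of `g` than the switcher that minimises `g`. -/
lemma sum_min_le_of_mem_simulableLaws {P : (Fin m → X) → ℝ} (hP : P ∈ stdSimplex ℝ (Fin m → X))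
    {p : X → ℝ} (hp : p ∈ simulableLaws P) (g : X → ℝ) {s : (Fin m → X) → Fin m}
    (hs : ∀ (x : Fin m → X) (l : Fin m), g (x (s x)) ≤ g (x l)) :
    ∑ x, P x * g (x (s x)) ≤ ∑ a, p a * g a := by
  set M := ∑ a, |g a| with hM
  have hgM : ∀ a, |g a| ≤ M := fun a =>
    Finset.single_le_sum (f := fun a => |g a|) (fun _ _ => abs_nonneg _) (Finset.mem_univ a)
  have hmem : ∀ a, g a ∈ Set.Icc (-M) M := fun a => abs_le.1 (hgM a)
  set I : ℝ → ℝ → ℝ := fun b t => Set.indicator {t | t ≤ b} (fun _ => (1 : ℝ)) t with hI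
  have hint : ∀ (r b : ℝ), IntervalIntegrable (fun t => r * I b t) MeasureTheory.volume (-M) M :=
    fun r b => (intervalIntegrable_indicator_le _ _ _).const_mul r
  -- Layer cake: `g a + M` is the length of the set of levels in `[-M, M]` that are at most `g a`.
  have hval : ∀ a, ∫ t in (-M)..M, I (g a) t = g a + M := fun a => by
    rw [hI, integral_indicator_le (hmem a)]; ring
  have hL : ∫ t in (-M)..M, ∑ x, P x * I (g (x (s x))) t = ∑ x, P x * (g (x (s x)) + M) := by
    rw [intervalIntegral.integral_finsetSum fun x _ => hint _ _]
    exact Finset.sum_congr rfl fun x _ => by rw [intervalIntegral.integral_const_mul, hval]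
  have hR : ∫ t in (-M)..M, ∑ a, p a * I (g a) t = ∑ a, p a * (g a + M) := by
    rw [intervalIntegral.integral_finsetSum fun x _ => hint _ _]
    exact Finset.sum_congr rfl fun x _ => by rw [intervalIntegral.integral_const_mul, hval]
  have hle : ∫ t in (-M)..M, ∑ x, P x * I (g (x (s x))) t ≤ ∫ t in (-M)..M, ∑ a, p a * I (g a) t := by
    refine intervalIntegral.integral_mono_on
      (by have : 0 ≤ M := Finset.sum_nonneg fun _ _ => abs_nonneg _
          linarith)
      (by simpa only [Finset.sum_fn] using
        IntervalIntegrable.sum Finset.univ fun x _ => hint (P x) (g (x (s x))))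
      (by simpa only [Finset.sum_fn] using
        IntervalIntegrable.sum Finset.univ fun a _ => hint (p a) (g a)) fun t _ => ?_
    -- The greedy switcher outputs a letter in `{g ≥ t}` exactly when all offered letters lie there,
    -- which is the event bounded in the definition of `C`.
    have h := hp.2 (Finset.univ.filter fun a => t ≤ g a)
    rw [Finset.sum_filter, Finset.sum_filter] at h
    refine le_trans (le_of_eq ?_) (h.trans (le_of_eq ?_))
    · refine Finset.sum_congr rfl fun x _ => ?_
      have : (∀ l, x l ∈ Finset.univ.filter fun a => t ≤ g a) ↔ t ≤ g (x (s x)) := by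
        simp only [Finset.mem_filter, Finset.mem_univ, true_and]
        exact ⟨fun h => h _, fun h l => h.trans (hs x l)⟩
      simp only [this, hI, Set.indicator_apply, Set.mem_ofPred_eq]
      split_ifs <;> simp
    · refine Finset.sum_congr rfl fun a _ => ?_
      simp only [hI, Set.indicator_apply, Set.mem_ofPred_eq]
      split_ifs <;> simp
  rw [hL, hR] at hle
  simp_rw [mul_add, Finset.sum_add_distrib, ← Finset.sum_mul, hP.2, hp.1.2] at hle
  linarith

/-- Every law in `C` is the output law of a randomized switching rule. -/
lemma exists_switchLaw_eq (hm : 1 ≤ m) {P : (Fin m → X) → ℝ}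
    (hP : P ∈ stdSimplex ℝ (Fin m → X)) {p : X → ℝ} (hp : p ∈ simulableLaws P) :
    ∃ f : (Fin m → X) → Fin m → ℝ, (∀ x, f x ∈ stdSimplex ℝ (Fin m)) ∧ switchLaw P f = p := by
  set F : Set ((Fin m → X) → Fin m → ℝ) := {f | ∀ x, f x ∈ stdSimplex ℝ (Fin m)} with hF
  by_contra hcon
  have hnot : p ∉ switchLaw P '' F := fun ⟨f, hf, h⟩ => hcon ⟨f, hf, h⟩
  have hcont : Continuous (switchLaw P) := by
    refine continuous_pi fun a => ?_
    unfold switchLaw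
    refine continuous_finsetSum _ fun x _ => continuous_const.mul
      (continuous_finsetSum _ fun l _ => ?_)
    split_ifs
    · fun_prop
    · exact continuous_const
  have hclosed : IsClosed (switchLaw P '' F) := (isCompact_channels.image hcont).isClosed
  have hlin : IsLinearMap ℝ (switchLaw P) := by
    constructor
    · intro f f'
      funext a
      simp only [switchLaw, Pi.add_apply, ← Finset.sum_add_distrib, ← mul_add]
      refine Finset.sum_congr rfl fun x _ => ?_
      congr 1
      exact Finset.sum_congr rfl fun l _ => by split_ifs <;> simp
    · intro c f
      funext a
      simp only [switchLaw, Pi.smul_apply, smul_eq_mul, Finset.mul_sum]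
      refine Finset.sum_congr rfl fun x _ => Finset.sum_congr rfl fun l _ => ?_
      split_ifs
      · ring
      · simp
  have hFconv : Convex ℝ F := by
    intro f hf f' hf' c c' hc hc' hcc x
    exact convex_stdSimplex ℝ (Fin m) (hf x) (hf' x) hc hc' hcc
  obtain ⟨φ, u, hu, hup⟩ := geometric_hahn_banach_closed_point (hFconv.is_linear_image hlin)
    hclosed hnot
  -- The sign turns the functional, which is larger at `p` than on the image, into a cost whose mean
  -- under `p` is below that of every rule, the greedy one included.
  set g : X → ℝ := fun a => -φ (fun j => if a = j then 1 else 0) with hg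
  have hφ : ∀ v : X → ℝ, φ v = -∑ a, v a * g a := by
    intro v
    have := LinearMap.pi_apply_eq_sum_univ (φ : (X → ℝ) →ₗ[ℝ] ℝ) v
    simp only [ContinuousLinearMap.coe_coe, smul_eq_mul] at this
    rw [this]
    simp [hg]
  obtain ⟨s, hs⟩ := exists_argmin_switch hm g
  have h1 := hu _ ⟨pureSwitch s, pureSwitch_mem s, rfl⟩
  rw [hφ, sum_switchLaw_pureSwitch_mul] at h1
  rw [hφ] at hup
  have := sum_min_le_of_mem_simulableLaws hP hp g hs
  linarith

lemma isCompact_simulableLaws (P : (Fin m → X) → ℝ) : IsCompact (simulableLaws P) := by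
  have : IsClosed {p : X → ℝ | ∀ V : Finset X,
      ∑ x : Fin m → X with ∀ l, x l ∈ V, P x ≤ ∑ i ∈ V, p i} := by
    simp only [Set.ofPred_forall]
    exact isClosed_iInter fun V => isClosed_le continuous_const (by fun_prop)
  exact (isCompact_stdSimplex ℝ X).inter_right this

lemma simulableLaws_nonempty (hm : 1 ≤ m) {P : (Fin m → X) → ℝ}
    (hP : P ∈ stdSimplex ℝ (Fin m → X)) : (simulableLaws P).Nonempty := by
  -- The switch that never moves: its letter is in `V` whenever all letters are.
  set s : (Fin m → X) → Fin m := fun _ => ⟨0, hm⟩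
  refine ⟨switchLaw P (pureSwitch s), ⟨switchLaw_nonneg hP (pureSwitch_mem s),
    sum_switchLaw hP (pureSwitch_mem s)⟩, fun V => ?_⟩
  have h := sum_switchLaw_pureSwitch_mul P s fun a => if a ∈ V then 1 else 0
  simp only [mul_ite, mul_one, mul_zero, Finset.sum_ite_mem, Finset.univ_inter] at h
  rw [h, Finset.sum_filter]
  refine Finset.sum_le_sum fun x _ => ?_
  have := hP.1 x
  by_cases hx : ∀ l, x l ∈ V
  · rw [if_pos hx, if_pos (hx _)]
  · rw [if_neg hx]; split_ifs
    exacts [this, le_rfl]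

end Simulation

/-- Conditional laws that depend on the past only multiply to a law. -/
lemma sum_prod_causal {A : Type*} [Fintype A] [Nonempty A] {n : ℕ}
    (g : Fin n → (Fin n → A) → A → ℝ)
    (hdep : ∀ k s s', (∀ j < k, s j = s' j) → g k s = g k s') (hg : ∀ k s, ∑ a, g k s a = 1) :
    ∑ s : Fin n → A, ∏ k, g k s (s k) = 1 := by
  induction n with
  | zero => simp
  | succ n ih =>
    -- A filler for the last coordinate: by `hdep` no conditional law looks at it, so the last
    -- factor can be summed out first.
    set a₀ : A := Classical.arbitrary A
    have h := ih (fun k s => g k.castSucc (Fin.snoc s a₀ : Fin (n + 1) → A))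
      (fun k s s' hs => hdep _ _ _ fun j hj => by
        have hjn : j.val < n := lt_trans (Fin.lt_def.1 hj) k.2
        obtain ⟨i, rfl⟩ : ∃ i : Fin n, j = i.castSucc := ⟨⟨j, hjn⟩, rfl⟩
        simpa using hs i (by simpa using hj))
      (fun k s => hg _ _)
    rw [← h, ← (Fin.snocEquiv fun _ => A).sum_comp, Fintype.sum_prod_type, Finset.sum_comm]
    refine Finset.sum_congr rfl fun s _ => ?_
    have hcast : ∀ (k : Fin n) (a : A), g k.castSucc (Fin.snoc s a : Fin (n + 1) → A) =
        g k.castSucc (Fin.snoc s a₀ : Fin (n + 1) → A) := fun k a => hdep _ _ _ fun j hj => by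
      have hjn : j.val < n := lt_trans (Fin.lt_def.1 hj) k.2
      obtain ⟨i, rfl⟩ : ∃ i : Fin n, j = i.castSucc := ⟨⟨j, hjn⟩, rfl⟩
      simp
    have hlast : ∀ a : A, g (Fin.last n) (Fin.snoc s a : Fin (n + 1) → A) =
        g (Fin.last n) (Fin.snoc s a₀ : Fin (n + 1) → A) := fun a => hdep _ _ _ fun j hj => by
      have hjn : j.val < n := Fin.lt_def.1 hj
      obtain ⟨i, rfl⟩ : ∃ i : Fin n, j = i.castSucc := ⟨⟨j, hjn⟩, rfl⟩
      simp
    change ∑ a, ∏ k, g k (Fin.snoc s a : Fin (n + 1) → A) ((Fin.snoc s a : Fin (n + 1) → A) k) = _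
    simp only [Fin.prod_univ_castSucc, Fin.snoc_castSucc, Fin.snoc_last,
      hcast, hlast]
    rw [← Finset.mul_sum, hg, mul_one]

/-! ### Lower bound through the sets of offered letters -/

section Candidates

variable {X Y : Type*} [Fintype X] [DecidableEq X] {m : ℕ}

lemma OneStepStrategy.sum_prob {X : Type*} {m n : ℕ} (hm : 1 ≤ m) (σ : OneStepStrategy X m n)
    (x : Fin n → Fin m → X) : ∑ s, σ.prob x s = 1 := by
  have : Nonempty (Fin m) := ⟨⟨0, hm⟩⟩
  refine sum_prod_causal (fun k s => σ.law k (fun j => x j) fun j => s j) (fun k s s' h => ?_)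
    fun k s => (σ.law_mem _ _ _).2
  have : (fun j : Set.Iio k => s j) = fun j : Set.Iio k => s' j := funext fun j => h j j.2
  simp only [this]

/-- The set of letters offered to the switcher. -/
def candidates {X : Type*} [DecidableEq X] {m : ℕ} (hm : 1 ≤ m) (x : Fin m → X) :
    CandidateSet X m :=
  ⟨Finset.univ.image x, ⟨x ⟨0, hm⟩, Finset.mem_image_of_mem x (Finset.mem_univ _)⟩,
    Finset.card_image_le.trans (by simp)⟩

lemma candidateLaw_eq (hm : 1 ≤ m) (P : (Fin m → X) → ℝ) (V : CandidateSet X m) :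
    ∑ x with candidates hm x = V, P x = candidateLaw P V := by
  unfold candidateLaw candidates
  refine Finset.sum_congr ?_ fun _ _ => rfl
  ext x
  simp [Subtype.ext_iff]

lemma sum_candidateLaw_mul (hm : 1 ≤ m) (P : (Fin m → X) → ℝ) (F : CandidateSet X m → ℝ) :
    ∑ V, candidateLaw P V * F V = ∑ x, P x * F (candidates hm x) := by
  rw [← Finset.sum_fiberwise Finset.univ (candidates hm)]
  refine Finset.sum_congr rfl fun V _ => ?_
  rw [← candidateLaw_eq hm, Finset.sum_mul]
  refine Finset.sum_congr rfl fun x hx => ?_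
  rw [(Finset.mem_filter.1 hx).2]

lemma candidateLaw_mem (hm : 1 ≤ m) {P : (Fin m → X) → ℝ} (hP : P ∈ stdSimplex ℝ (Fin m → X)) :
    candidateLaw P ∈ stdSimplex ℝ (CandidateSet X m) := by
  refine ⟨fun V => Finset.sum_nonneg fun x _ => hP.1 x, ?_⟩
  have := sum_candidateLaw_mul hm P fun _ => 1
  simp only [mul_one] at this
  rw [this, hP.2]

lemma candidateDist_candidates_le {X Y : Type*} [DecidableEq X] {m : ℕ} (hm : 1 ≤ m)
    (d : X → Y → ℝ) (x : Fin m → X) (l : Fin m) (y : Y) :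
    candidateDist d (candidates hm x) y ≤ d (x l) y :=
  Finset.inf'_le _ (Finset.mem_image_of_mem x (Finset.mem_univ l))

/-- No strategy beats the encoder that sees the sets of offered letters. -/
lemma codebookDist_candidates_le_expectedDist (hm : 1 ≤ m) {P : (Fin m → X) → ℝ}
    (hP : P ∈ stdSimplex ℝ (Fin m → X)) (d : X → Y → ℝ) {n : ℕ} (B : Codebook Y n)
    (σ : OneStepStrategy X m n) :
    ∑ v : Fin n → CandidateSet X m, (∏ k, candidateLaw P (v k)) *
      codebookDist (candidateDist d) v B ≤ expectedDist P d B σ := by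
  have h := sum_prodLaw_comp (ι := Fin n) (candidates hm) P
    fun v => codebookDist (candidateDist d) v B
  simp only [candidateLaw_eq] at h
  rw [← h, expectedDist]
  refine Finset.sum_le_sum fun x _ =>
    mul_le_mul_of_nonneg_left ?_ (Finset.prod_nonneg fun k _ => hP.1 _)
  rw [← one_mul (codebookDist _ _ _), ← σ.sum_prob hm x, Finset.sum_mul]
  refine Finset.sum_le_sum fun s _ => mul_le_mul_of_nonneg_left ?_
    (Finset.prod_nonneg fun k _ => (σ.law_mem _ _ _).1 _)
  refine Finset.le_inf' _ _ fun b hb => (Finset.inf'_le _ hb).trans ?_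
  unfold blockDist
  gcongr with k
  exact candidateDist_candidates_le hm d (x k) (s k) (b k)

lemma rateDist_le_infAchievable [Fintype Y] (hm : 1 ≤ m) {P : (Fin m → X) → ℝ}
    (hP : P ∈ stdSimplex ℝ (Fin m → X)) (d : X → Y → ℝ) (D : ℝ) :
    rateDist (candidateLaw P) (candidateDist d) D ≤ infAchievable P d D := by
  refine le_iInf₂ fun R hR => ?_
  obtain ⟨B, σ, hBD, hlim⟩ := hR
  refine ge_of_tendsto ((continuous_coe_real_ereal.tendsto R).comp hlim) ?_
  filter_upwards [eventually_ge_atTop 1] with n hn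
  exact rateDist_le_log_card (candidateLaw_mem hm hP) _ (by omega) (B n)
    ((codebookDist_candidates_le_expectedDist hm hP d (B n) (σ n)).trans (hBD n hn))

/-- The minimum distortion is reached by the switcher that minimises `min_y d(x, y)`. -/
lemma minDistortion_candidateLaw_eq [Fintype Y] [Nonempty Y] (hm : 1 ≤ m) (P : (Fin m → X) → ℝ)
    (d : X → Y → ℝ) {s : (Fin m → X) → Fin m}
    (hs : ∀ (x : Fin m → X) (l : Fin m), Finset.univ.inf' Finset.univ_nonempty (d (x (s x))) ≤
      Finset.univ.inf' Finset.univ_nonempty (d (x l))) :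
    minDistortion (candidateLaw P) (candidateDist (m := m) d) =
      ∑ x, P x * Finset.univ.inf' Finset.univ_nonempty (d (x (s x))) := by
  unfold minDistortion
  rw [sum_candidateLaw_mul hm P fun V =>
    Finset.univ.inf' Finset.univ_nonempty (candidateDist d V)]
  refine Finset.sum_congr rfl fun x _ => ?_
  congr 1
  refine le_antisymm ?_ ?_
  · exact Finset.le_inf' _ _ fun y hy => (Finset.inf'_le _ hy).trans
      (candidateDist_candidates_le hm d x (s x) y)
  · refine Finset.le_inf' _ _ fun y hy => Finset.le_inf' _ _ fun a ha => ?_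
    obtain ⟨l, -, rfl⟩ := Finset.mem_image.1 ha
    exact (hs x l).trans (Finset.inf'_le _ hy)

end Candidates

/-! ### Memoryless strategies produce i.i.d. letters -/

section Memoryless

variable {X Y : Type*} {m : ℕ}

/-- The strategy that draws each switch position from `f`, applied to the current outputs. -/
def memorylessStrategy (n : ℕ) {f : (Fin m → X) → Fin m → ℝ}
    (hf : ∀ x, f x ∈ stdSimplex ℝ (Fin m)) : OneStepStrategy X m n where
  law k x _ := f (x ⟨k, Set.mem_Iic.2 le_rfl⟩)
  law_mem _ _ _ := hf _

lemma expectedDist_memorylessStrategy [Fintype X] [DecidableEq X] (P : (Fin m → X) → ℝ)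
    (d : X → Y → ℝ) {n : ℕ} (B : Codebook Y n) {f : (Fin m → X) → Fin m → ℝ}
    (hf : ∀ x, f x ∈ stdSimplex ℝ (Fin m)) :
    expectedDist P d B (memorylessStrategy n hf) =
      ∑ z : Fin n → X, (∏ k, switchLaw P f (z k)) * codebookDist d z B := by
  have h := sum_prodLaw_comp (ι := Fin n) (fun z : (Fin m → X) × Fin m => z.1 z.2)
    (fun z => P z.1 * f z.1 z.2) fun z => codebookDist d z B
  have hlaw : ∀ a : X, ∑ z : (Fin m → X) × Fin m with z.1 z.2 = a, P z.1 * f z.1 z.2 =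
      switchLaw P f a := by
    intro a
    rw [Finset.sum_filter, Fintype.sum_prod_type, switchLaw]
    refine Finset.sum_congr rfl fun x _ => ?_
    rw [Finset.mul_sum]
    exact Finset.sum_congr rfl fun l _ => by split_ifs <;> simp
  simp only [hlaw] at h
  rw [← h, expectedDist, (Equiv.sum_comp (Equiv.arrowProdEquivProdArrow (Fin n)
    (fun _ => Fin m → X) (fun _ => Fin m)).symm _).symm, Fintype.sum_prod_type]
  refine Finset.sum_congr rfl fun x _ => ?_
  rw [Finset.mul_sum]
  refine Finset.sum_congr rfl fun s _ => ?_
  rw [← mul_assoc]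
  congr 1
  rw [OneStepStrategy.prob, ← Finset.prod_mul_distrib]
  rfl

end Memoryless

/-- For `R ≥ 0` rounding up at most doubles `exp (n * R)`, which costs `log 2 / n` in rate. -/
lemma tendsto_log_ceil_exp_div {R : ℝ} (hR : 0 ≤ R) :
    Tendsto (fun n : ℕ => Real.log (⌈Real.exp (n * R)⌉₊ : ℝ) / n) atTop (𝓝 R) := by
  have hupper : Tendsto (fun n : ℕ => R + Real.log 2 / n) atTop (𝓝 R) := by
    simpa using tendsto_const_nhds.add (tendsto_const_div_atTop_nhds_zero_nat (Real.log 2))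
  refine tendsto_of_tendsto_of_tendsto_of_le_of_le' tendsto_const_nhds hupper ?_ ?_
  · filter_upwards [eventually_gt_atTop 0] with n hn
    have hn0 : (0 : ℝ) < n := by exact_mod_cast hn
    rw [le_div_iff₀ hn0, mul_comm]
    refine (Real.log_exp (n * R)).ge.trans ?_
    exact Real.log_le_log (Real.exp_pos _) (Nat.le_ceil _)
  · filter_upwards [eventually_gt_atTop 0] with n hn
    have hn0 : (0 : ℝ) < n := by exact_mod_cast hn
    have h1 : 1 ≤ Real.exp (n * R) := Real.one_le_exp (by positivity)
    have h2 : (⌈Real.exp (n * R)⌉₊ : ℝ) ≤ 2 * Real.exp (n * R) :=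
      (Nat.ceil_lt_add_one (Real.exp_pos _).le).le.trans (by linarith)
    have h3 : (0 : ℝ) < ⌈Real.exp (n * R)⌉₊ := (Real.exp_pos _).trans_le (Nat.le_ceil _)
    rw [div_le_iff₀ hn0, add_mul, div_mul_cancel₀ _ hn0.ne', mul_comm R]
    refine (Real.log_le_log h3 h2).trans (le_of_eq ?_)
    rw [Real.log_mul two_ne_zero (Real.exp_pos _).ne', Real.log_exp, add_comm]

/-! ### Upper bound by coding for a simulated law -/

section Direct

variable {X Y : Type*} [Fintype X] [DecidableEq X] [Fintype Y] [Nonempty Y] {m : ℕ}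

/-- The codebook of all reconstruction blocks. -/
def fullCodebook (Y : Type*) [Fintype Y] [Nonempty Y] (n : ℕ) : Codebook Y n :=
  ⟨Finset.univ, Finset.univ_nonempty⟩

lemma exists_expectedDist_fullCodebook_le (hm : 1 ≤ m) {P : (Fin m → X) → ℝ}
    (hP : P ∈ stdSimplex ℝ (Fin m → X)) (d : X → Y → ℝ) {n : ℕ} (hn : 1 ≤ n) :
    ∃ σ : OneStepStrategy X m n, expectedDist P d (fullCodebook Y n) σ ≤
      minDistortion (candidateLaw P) (candidateDist (m := m) d) := by
  set g : X → ℝ := fun a => Finset.univ.inf' Finset.univ_nonempty (d a) with hg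
  obtain ⟨s, hs⟩ := exists_argmin_switch hm g
  have hy : ∀ a, ∃ y, g a = d a y := fun a => by
    obtain ⟨y, -, h⟩ := Finset.exists_mem_eq_inf' (Finset.univ_nonempty (α := Y)) (d a)
    exact ⟨y, h⟩
  choose y hy using hy
  have hn0 : (0 : ℝ) < n := by exact_mod_cast hn
  refine ⟨memorylessStrategy n (pureSwitch_mem s), ?_⟩
  rw [expectedDist_memorylessStrategy, minDistortion_candidateLaw_eq hm P d hs]
  have hp1 := sum_switchLaw hP (pureSwitch_mem s)
  calc ∑ z : Fin n → X, (∏ k, switchLaw P (pureSwitch s) (z k)) *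
        codebookDist d z (fullCodebook Y n)
      ≤ ∑ z : Fin n → X, (∏ k, switchLaw P (pureSwitch s) (z k)) * ((∑ k, g (z k)) / n) := by
        refine Finset.sum_le_sum fun z _ => mul_le_mul_of_nonneg_left ?_
          (Finset.prod_nonneg fun k _ => switchLaw_nonneg hP (pureSwitch_mem s) _)
        refine (Finset.inf'_le _ (Finset.mem_univ fun k => y (z k))).trans (le_of_eq ?_)
        simp only [blockDist, hy]
    _ = (∑ k : Fin n, ∑ z : Fin n → X, (∏ j, switchLaw P (pureSwitch s) (z j)) * g (z k)) / n := by
        rw [Finset.sum_comm, Finset.sum_div]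
        refine Finset.sum_congr rfl fun z _ => ?_
        rw [← Finset.mul_sum, mul_div_assoc]
    _ = ∑ x, P x * g (x (s x)) := by
        simp_rw [sum_prodLaw_mul_apply hp1 _ g, sum_switchLaw_pureSwitch_mul]
        simp only [Finset.sum_const, Finset.card_univ, Fintype.card_fin, nsmul_eq_mul]
        field_simp
    _ ≤ _ := le_rfl

/-- The full codebook has rate exactly `log |Y|`. This covers rates so large that `⌈exp (n * R)⌉`
distinct words may not exist. -/
lemma infAchievable_le_log_card (hm : 1 ≤ m) {P : (Fin m → X) → ℝ}
    (hP : P ∈ stdSimplex ℝ (Fin m → X)) (d : X → Y → ℝ) {D : ℝ}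
    (hD : minDistortion (candidateLaw P) (candidateDist (m := m) d) ≤ D) :
    infAchievable P d D ≤ (Real.log (Fintype.card Y) : EReal) := by
  refine iInf₂_le (Real.log (Fintype.card Y)) ?_
  have h : ∀ n : ℕ, ∃ σ : OneStepStrategy X m n,
      1 ≤ n → expectedDist P d (fullCodebook Y n) σ ≤ D := fun n => by
    by_cases hn : 1 ≤ n
    · obtain ⟨σ, hσ⟩ := exists_expectedDist_fullCodebook_le hm hP d hn
      exact ⟨σ, fun _ => hσ.trans hD⟩
    · exact ⟨memorylessStrategy n (pureSwitch_mem fun _ => ⟨0, hm⟩), fun h => absurd h hn⟩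
  choose σ hσ using h
  refine ⟨fullCodebook Y, σ, hσ, tendsto_const_nhds.congr' ?_⟩
  filter_upwards [eventually_gt_atTop 0] with n hn
  have hn0 : (n : ℝ) ≠ 0 := by positivity
  simp only [fullCodebook, Finset.card_univ, Fintype.card_fun, Fintype.card_fin, Nat.cast_pow,
    Real.log_pow]
  field_simp

/-- Enlarging a codebook does not increase the distortion. -/
lemma codebookDist_anti {X Y : Type*} (d : X → Y → ℝ) {n : ℕ} (x : Fin n → X) {B B' : Codebook Y n}
    (h : B.1 ⊆ B'.1) : codebookDist d x B' ≤ codebookDist d x B :=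
  Finset.inf'_mono _ h B.2

/-- Random coding for the source simulated by a memoryless switching rule. -/
lemma infAchievable_le_of_jointInfo_lt (hm : 1 ≤ m) {P : (Fin m → X) → ℝ}
    (hP : P ∈ stdSimplex ℝ (Fin m → X)) {d : X → Y → ℝ} (hd : ∀ x y, 0 ≤ d x y) {D R : ℝ}
    (hDmin : minDistortion (candidateLaw P) (candidateDist (m := m) d) ≤ D)
    {f : (Fin m → X) → Fin m → ℝ} (hf : ∀ x, f x ∈ stdSimplex ℝ (Fin m))
    {J : X → Y → ℝ} (hJ0 : ∀ x y, 0 ≤ J x y) (hJf : ∀ x, ∑ y, J x y = switchLaw P f x)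
    (hJD : ∑ x, ∑ y, J x y * d x y < D) (hR : jointInfo J < R) :
    infAchievable P d D ≤ (R : EReal) := by
  classical
  have hJ1 : ∑ x, ∑ y, J x y = 1 := by simp_rw [hJf]; exact sum_switchLaw hP hf
  have hR0 : 0 ≤ R := (jointInfo_nonneg hJ0 hJ1).trans hR.le
  rcases le_total (Real.log (Fintype.card Y)) R with hYR | hRY
  · exact (infAchievable_le_log_card hm hP d hDmin).trans (EReal.coe_le_coe_iff.2 hYR)
  refine iInf₂_le R ?_
  obtain ⟨N, hN⟩ := eventually_atTop.1 (exists_codebook_block hJ0 hJ1 hd hJD hR)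
  have h : ∀ n : ℕ, ∃ (B : Codebook Y n) (σ : OneStepStrategy X m n),
      (1 ≤ n → expectedDist P d B σ ≤ D) ∧ (N ≤ n → B.1.card = ⌈Real.exp (n * R)⌉₊) := by
    intro n
    by_cases hn : N ≤ n
    · obtain ⟨B, hBM, hBD⟩ := hN n hn ⌈Real.exp (n * R)⌉₊ (Nat.le_ceil _)
      have hM : ⌈Real.exp (n * R)⌉₊ ≤ Fintype.card (Fin n → Y) := by
        rw [Nat.ceil_le, Fintype.card_fun, Fintype.card_fin, Nat.cast_pow, Real.exp_nat_mul]
        refine pow_le_pow_left₀ (Real.exp_pos _).le ?_ n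
        exact (Real.le_log_iff_exp_le (by exact_mod_cast Fintype.card_pos)).1 hRY
      -- Random coding bounds the size only from above; padding gives the exact size, so that the
      -- rates converge to `R`.
      obtain ⟨B', hBB', hB'⟩ := Finset.exists_superset_card_eq hBM hM
      refine ⟨⟨B', B.2.mono hBB'⟩, memorylessStrategy n hf, fun _ => ?_, fun _ => hB'⟩
      rw [expectedDist_memorylessStrategy]
      refine le_trans (Finset.sum_le_sum fun z _ => ?_) hBD
      simp_rw [hJf]
      exact mul_le_mul_of_nonneg_left (codebookDist_anti d z hBB')
        (Finset.prod_nonneg fun k _ => switchLaw_nonneg hP hf _)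
    · by_cases hn1 : 1 ≤ n
      · obtain ⟨σ, hσ⟩ := exists_expectedDist_fullCodebook_le hm hP d hn1
        exact ⟨fullCodebook Y n, σ, fun _ => hσ.trans hDmin, fun h => absurd h hn⟩
      · exact ⟨fullCodebook Y n, memorylessStrategy n hf, fun h => absurd h hn1,
          fun h => absurd h hn⟩
  choose B σ hD hcard using h
  refine ⟨B, σ, hD, (tendsto_log_ceil_exp_div hR0).congr' ?_⟩
  filter_upwards [eventually_ge_atTop N] with n hn
  rw [hcard n hn]

lemma switchLaw_mix (P : (Fin m → X) → ℝ) (f f' : (Fin m → X) → Fin m → ℝ) (u v : ℝ) (a : X) :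
    switchLaw P (u • f + v • f') a = u * switchLaw P f a + v * switchLaw P f' a := by
  simp only [switchLaw, Finset.mul_sum, ← Finset.sum_add_distrib]
  refine Finset.sum_congr rfl fun x _ => Finset.sum_congr rfl fun l _ => ?_
  split_ifs
  · simp only [Pi.add_apply, Pi.smul_apply, smul_eq_mul]; ring
  · ring

/-- Above the minimum distortion, the helpful switcher does at least as well as any law that it
can simulate. -/
lemma infAchievable_le_rateDist (hm : 1 ≤ m) {P : (Fin m → X) → ℝ}
    (hP : P ∈ stdSimplex ℝ (Fin m → X)) {d : X → Y → ℝ} (hd : ∀ x y, 0 ≤ d x y) {D : ℝ}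
    (hDmin : minDistortion (candidateLaw P) (candidateDist (m := m) d) < D)
    {p : X → ℝ} (hp : p ∈ simulableLaws P) :
    infAchievable P d D ≤ rateDist p d D := by
  classical
  obtain ⟨f, hf, rfl⟩ := exists_switchLaw_eq hm hP hp
  refine le_iInf₂ fun W hW => EReal.le_of_forall_lt_iff_le.1 fun R hR => ?_
  rw [mutualInfo_eq_jointInfo _ fun x => (hW.1 x).2, EReal.coe_lt_coe_iff] at hR
  set p := switchLaw P f with hpdef
  set g : X → ℝ := fun a => Finset.univ.inf' Finset.univ_nonempty (d a) with hg
  obtain ⟨s, hs⟩ := exists_argmin_switch hm g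
  have hy : ∀ a, ∃ y, g a = d a y := fun a => by
    obtain ⟨y, -, h⟩ := Finset.exists_mem_eq_inf' (Finset.univ_nonempty (α := Y)) (d a)
    exact ⟨y, h⟩
  choose y₀ hy₀ using hy
  set p₀ := switchLaw P (pureSwitch s) with hp₀
  -- The greedy switcher followed by the best reconstruction of its letter, of distortion `D_min`. A
  -- share `t` of it makes the distortion strict, while continuity keeps the information below `R`
  -- for small `t > 0`.
  set J₀ : X → Y → ℝ := fun a y => if y = y₀ a then p₀ a else 0 with hJ₀
  set J : ℝ → X → Y → ℝ := fun t a y => (1 - t) * (p a * W a y) + t * J₀ a y with hJ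
  have hp0 : ∀ a, 0 ≤ p a := switchLaw_nonneg hP hf
  have hp₀0 : ∀ a, 0 ≤ p₀ a := switchLaw_nonneg hP (pureSwitch_mem s)
  have hJ₀0 : ∀ a y, 0 ≤ J₀ a y := fun a y => by
    simp only [hJ₀]; split_ifs
    exacts [hp₀0 a, le_rfl]
  have hJnn : ∀ t ∈ Set.Icc (0 : ℝ) 1, ∀ a y, 0 ≤ J t a y := fun t ht a y =>
    add_nonneg (mul_nonneg (by linarith [ht.2]) (mul_nonneg (hp0 a) ((hW.1 a).1 y)))
      (mul_nonneg ht.1 (hJ₀0 a y))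
  have hcont : ContinuousOn (fun t => jointInfo (J t)) (Set.Icc 0 1) := by
    refine continuousOn_jointInfo.comp (f := J) ?_ hJnn
    refine Continuous.continuousOn (continuous_pi fun a => continuous_pi fun y => ?_)
    simp only [hJ]
    fun_prop
  have hJzero : J 0 = fun a y => p a * W a y := by funext a y; simp [hJ]
  have hev : ∀ᶠ t in 𝓝[>] (0 : ℝ), jointInfo (J t) < R := by
    have h1 : Tendsto (fun t => jointInfo (J t)) (𝓝[Set.Icc 0 1] 0) (𝓝 (jointInfo (J 0))) :=
      hcont 0 (by simp)
    have h2 : Tendsto (fun t => jointInfo (J t)) (𝓝[>] 0) (𝓝 (jointInfo (J 0))) := by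
      refine h1.mono_left ?_
      rw [nhdsWithin_Icc_eq_nhdsGE (zero_lt_one' ℝ)]
      exact nhdsWithin_mono _ Set.Ioi_subset_Ici_self
    rw [hJzero] at h2
    exact h2.eventually (gt_mem_nhds hR)
  obtain ⟨t, htR, ht0, ht1⟩ := (hev.and (Ioo_mem_nhdsGT (zero_lt_one' ℝ))).exists
  have hdist₀ : ∑ a, ∑ y, J₀ a y * d a y =
      minDistortion (candidateLaw P) (candidateDist (m := m) d) := by
    rw [minDistortion_candidateLaw_eq hm P d hs, ← sum_switchLaw_pureSwitch_mul P s g]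
    refine Finset.sum_congr rfl fun a _ => ?_
    simp [hJ₀, hp₀, hy₀]
  refine infAchievable_le_of_jointInfo_lt hm hP hd hDmin.le
    (f := (1 - t) • f + t • pureSwitch s) (fun x => convex_stdSimplex ℝ (Fin m) (hf x)
      (pureSwitch_mem s x) (by linarith) ht0.le (by ring)) (hJnn t ⟨ht0.le, ht1.le⟩) (fun a => ?_)
    ?_ htR
  · rw [switchLaw_mix]
    simp only [hJ, hJ₀, Finset.sum_add_distrib, ← Finset.mul_sum, (hW.1 a).2, mul_one]
    simp [hpdef, hp₀]
  · calc ∑ a, ∑ y, J t a y * d a y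
        = (1 - t) * ∑ a, ∑ y, p a * W a y * d a y + t * ∑ a, ∑ y, J₀ a y * d a y := by
          simp only [hJ, Finset.mul_sum, ← Finset.sum_add_distrib]
          exact Finset.sum_congr rfl fun a _ => Finset.sum_congr rfl fun y _ => by ring
      _ < (1 - t) * D + t * D := by
          rw [hdist₀]
          exact add_lt_add_of_le_of_lt (mul_le_mul_of_nonneg_left hW.2 (by linarith))
            (mul_lt_mul_of_pos_left hDmin ht0)
      _ = D := by ring

/-- The mean of `min_y d(a, y)` under a law in `C` is at least its mean under the greedy switcher,
which is `D_min`; hence no channel is feasible. -/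
lemma rateDist_eq_top_of_lt_minDistortion (hm : 1 ≤ m) {P : (Fin m → X) → ℝ}
    (hP : P ∈ stdSimplex ℝ (Fin m → X)) (d : X → Y → ℝ) {D : ℝ}
    (hD : D < minDistortion (candidateLaw P) (candidateDist (m := m) d))
    {p : X → ℝ} (hp : p ∈ simulableLaws P) : rateDist p d D = ⊤ := by
  refine iInf₂_eq_top.2 fun W hW => absurd hW.2 (not_le.2 (hD.trans_le ?_))
  set g : X → ℝ := fun a => Finset.univ.inf' Finset.univ_nonempty (d a) with hg
  obtain ⟨s, hs⟩ := exists_argmin_switch hm g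
  rw [minDistortion_candidateLaw_eq hm P d hs]
  refine (sum_min_le_of_mem_simulableLaws hP hp g hs).trans (Finset.sum_le_sum fun a _ => ?_)
  calc p a * g a = ∑ y, p a * W a y * g a := by
        rw [← Finset.sum_mul, ← Finset.mul_sum, (hW.1 a).2, mul_one]
    _ ≤ ∑ y, p a * W a y * d a y := Finset.sum_le_sum fun y hy =>
        mul_le_mul_of_nonneg_left (Finset.inf'_le _ hy) (mul_nonneg (hp.1.1 a) ((hW.1 a).1 y))

lemma helpfulRate_le_rateDist (hm : 1 ≤ m) {P : (Fin m → X) → ℝ}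
    (hP : P ∈ stdSimplex ℝ (Fin m → X)) {d : X → Y → ℝ} (hd : ∀ x y, 0 ≤ d x y) (D : ℝ)
    {p : X → ℝ} (hp : p ∈ simulableLaws P) : helpfulRate P d D ≤ rateDist p d D := by
  unfold helpfulRate
  split_ifs with h
  · exact iSup₂_le fun D' hD' => (infAchievable_le_rateDist hm hP hd (h ▸ hD') hp).trans
      (rateDist_antitone p d hD'.le)
  · rcases lt_or_gt_of_ne h with h | h
    · rw [rateDist_eq_top_of_lt_minDistortion hm hP d h hp]; exact le_top
    · exact infAchievable_le_rateDist hm hP hd h hp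

lemma rateDist_le_helpfulRate (hm : 1 ≤ m) {P : (Fin m → X) → ℝ}
    (hP : P ∈ stdSimplex ℝ (Fin m → X)) (d : X → Y → ℝ) (D : ℝ) :
    rateDist (candidateLaw P) (candidateDist d) D ≤ helpfulRate P d D := by
  unfold helpfulRate
  split_ifs
  · exact (rateDist_le_iSup_gt (candidateLaw_mem hm hP).1 _ D).trans
      (iSup₂_mono fun D' _ => rateDist_le_infAchievable hm hP d D')
  · exact rateDist_le_infAchievable hm hP d D

end Direct

end HelpfulAVS

theorem corollary1 {X Y : Type*} [Fintype X] [DecidableEq X] [Fintype Y] [Nonempty Y]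
    (m : ℕ) (hm : 1 ≤ m)
    (P : (Fin m → X) → ℝ) (hP : P ∈ stdSimplex ℝ (Fin m → X))
    (d : X → Y → ℝ) (hd : ∀ x y, 0 ≤ d x y) (D : ℝ) :
    ∃ r : EReal,
      IsLeast ((fun p => HelpfulAVS.rateDist p d D) '' HelpfulAVS.simulableLaws P) r ∧
      HelpfulAVS.rateDist (HelpfulAVS.candidateLaw P) (HelpfulAVS.candidateDist d) D
        ≤ HelpfulAVS.helpfulRate P d D ∧
      HelpfulAVS.helpfulRate P d D ≤ r := by
  obtain ⟨r, hr⟩ := HelpfulAVS.exists_isLeast_rateDist (HelpfulAVS.isCompact_simulableLaws P)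
    (HelpfulAVS.simulableLaws_nonempty hm hP) (fun p hp => hp.1.1) d D
  refine ⟨r, hr, HelpfulAVS.rateDist_le_helpfulRate hm hP d D, ?_⟩
  obtain ⟨p, hp, rfl⟩ := hr.1
  exact HelpfulAVS.helpfulRate_le_rateDist hm hP hd D hp
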